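/- A signed graph is a finite simple graph with a sign $+1$ or $-1$ on every edge; its adjacency matrix has the sign of the edge $ij$ as its $(i,j)$ entry if $i,j$ are adjacent and $0$ otherwise, and its spectral radius $\rho$ is the largest absolute value of an eigenvalue of this matrix. A cycle is unbalanced if the product of its edge signs is $-1$, and balanced otherwise. Two signed graphs are switching isomorphic if one is isomorphic to a signed graph obtained from the other by reversing the signs of all edges between some vertex set $S$ and its complement. "Attaching a path of $m$ vertices at $v$" means adding a path on $m$ new vertices and joining its first vertex to $v$; a pendant edge is the case $m=1$. All edges whose sign is not specified below are positive. Put $\lambda^\ast=\sqrt{2+\sqrt5}$. **Lemma.** Every signed graph $\dot G$ that is switching isomorphic to a member of one of the following families satisfies $\rho(\dot G)<\lambda^\ast$. (iii) - $\dot{\mathcal C}_k^{1,k/2+1}$ ($k\ge4$ even): an unbalanced $k$-cycle with a pendant edge at each of two opposite vertices. - $\dot G_0^k$ ($k\ge 12$ even): a balanced $k$-cycle $c_0c_1\dots c_{k-1}$ with all edges positive, a vertex $u$ joined to $c_1$ by a positive and to $c_{k-1}$ by a negative edge, and a pendant edge at $u$. - $\dot U_6^{n_1,n_2}$ ($n_1,n_2\ge1$):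 an unbalanced $6$-cycle with paths of $n_1$ and $n_2$ vertices attached at two opposite vertices. - $\dot{\mathcal C}_4[n_1,1,n_3,1]$ ($n_1,n_3\ge1$), where $\dot{\mathcal C}_4[n_1,n_2,n_3,n_4]$ is an unbalanced $4$-cycle with paths of $n_1,n_2,n_3,n_4$ vertices attached at its consecutive vertices. - $\dot S_1^n$ ($n\ge8$): a balanced $6$-cycle $c_0\dots c_5$ with all edges positive, a vertex $u$ joined to $c_1$ by a positive and to $c_5$ by a negative edge, and a path of $n-7$ vertices attached at $u$. - $\dot S_2^n$ ($n\ge10$): an unbalanced $6$-cycle $0,1,\dots,5$, a vertex $6$ joined to $0,2,4$, and vertices $7,8$ with edges $07,78,86$, signed such that the $4$-cycles $0126$, $2346$, $4506$, $0786$ are unbalanced, with a path of $n-9$ vertices attached at the vertex $3$. (iv) $[\dot G,v,s,u,\dot H]$ with $s\ge3$, where $(\dot G,v)$ and $(\dot H,u)$ are (independently) any of the pairs listed below. It is the disjoint union of $\dot G$, $\dot H$ and the signed graph $\dot T_{2s}'''$ together with two more edges $vv_1$ and $uv_s$. Here $\dot T_{2s}'''$ has the vertices $v_1,\dots,v_s,u_2,\dots,u_{s-1}$,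 positive edges $v_iv_{i+1}$ and $v_iu_{i+1}$, and negative edges $u_iu_{i+1}$ and $u_iv_{i+1}$. The pairs are: - $(\dot G_4^{12},v_{12})$: three unbalanced $4$-cycles $0143$, $1254$, $4576$ (vertices $0,\dots,7$, ten edges) with a path of $4$ vertices attached at $0$; $v_{12}$ is the end of this path. - $(\dot G_2^{9},v_{9})$: two unbalanced $4$-cycles $0143$, $1254$ sharing the edge $14$ (vertices $0,\dots,5$, seven edges) with a pendant edge at $4$ and a path of $2$ vertices attached at $0$; $v_9$ is the end of this path. - $(T_{a,1,a-1},v_{a-1})$, $a\ge3$: the tree consisting of three paths with $a$, $1$ and $a-1$ edges with one common end vertex; $v_{a-1}$ is the other end of the path with $a-1$ edges. - $(\dot Q'_{n_1,n_1},v_{n_1})$, $n_1\ge1$: $\dot{\mathcal C}_4[n_1,1,n_1,0]$; $v_{n_1}$ is the end of one of the two attached paths of $n_1$ vertices, namely of the one attached at the third vertex of the $4$-cycle. - $(\dot G_5^{10},v_{10})$: $\dot{\mathcal C}_4[2,4,0,0]$; $v_{10}$ is the end of the attached path of $4$ vertices. - $(P_4,v_2)$: the path with $4$ vertices; $v_2$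 is an inner vertex. -/

import Mathlib

/-- A signed graph on the vertex set `V`, i.e. a simple graph together with a sign `+1` or `-1` on
every edge, encoded by one symmetric function: `sgn i j` is the sign of the edge `ij` if `i` and `j`
are adjacent, and `0` if they are not adjacent. -/
structure SignedGraph (V : Type*) where
  sgn : V → V → SignType
  symm : ∀ i j, sgn i j = sgn j i
  irrefl : ∀ i, sgn i i = 0

namespace SignedGraph

/-! ### Adjacency matrix, spectral radius, switching isomorphism -/

/-- The (real, symmetric) adjacency matrix. -/
noncomputable def adjMatrix {V : Type*} (G : SignedGraph V) : Matrix V V ℝ :=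
  Matrix.of fun i j => ((G.sgn i j : SignType) : ℝ)

theorem adjMatrix_isHermitian {V : Type*} (G : SignedGraph V) : G.adjMatrix.IsHermitian := by
  ext i j
  simp [adjMatrix, G.symm i j]

/-- The spectral radius: the largest absolute value of an eigenvalue of the adjacency matrix. -/
noncomputable def rho {V : Type*} [Fintype V] [DecidableEq V] (G : SignedGraph V) : ℝ :=
  ⨆ i, |G.adjMatrix_isHermitian.eigenvalues i|

open Classical in
/-- Switching with respect to a vertex set `S`: reverse the sign of every edge with exactly one end
in `S`. -/
noncomputable def switch {V : Type*} (G : SignedGraph V) (S : Set V) : SignedGraph V where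
  sgn i j := if (i ∈ S ↔ j ∈ S) then G.sgn i j else -G.sgn i j
  symm i j := by simp only [G.symm i j, iff_comm]
  irrefl i := by simp [G.irrefl i]

/-- `G` is switching isomorphic to `H`: it is isomorphic to a signed graph that arises from `H` by
switching. -/
def SwitchingIso {V W : Type*} (G : SignedGraph V) (H : SignedGraph W) : Prop :=
  ∃ (S : Set W) (e : V ≃ W), ∀ i j, G.sgn i j = (H.switch S).sgn (e i) (e j)

/-! ### Building blocks -/

/-- The signed graph on `0, …, n - 1` with the given lists of positive and of negative edges. -/
def ofEdges (n : ℕ) (pos neg : List (ℕ × ℕ)) : SignedGraph (Fin n) where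
  sgn i j :=
    if i = j then 0
    else if (i.val, j.val) ∈ pos ∨ (j.val, i.val) ∈ pos then 1
    else if (i.val, j.val) ∈ neg ∨ (j.val, i.val) ∈ neg then -1
    else 0
  symm i j := by simp only [eq_comm, or_comm]
  irrefl i := by simp

/-- The path `P_n` with vertices `0, …, n - 1` in this order (all edges positive). -/
def path (n : ℕ) : SignedGraph (Fin n) where
  sgn i j := if i.val + 1 = j.val ∨ j.val + 1 = i.val then 1 else 0
  symm i j := by simp only [or_comm]
  irrefl i := by simp

/-- For `3 ≤ k`, the cycle `0, 1, …, k - 1, 0` in which the edge joining `k - 1` and `0` has the sign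
`ε` and every other edge is positive. So the sign of the cycle is `ε`. -/
def cycle (k : ℕ) (ε : SignType) : SignedGraph (Fin k) where
  sgn i j :=
    if i.val + 1 = j.val ∨ j.val + 1 = i.val then 1
    else if i ≠ j ∧ ((i.val = 0 ∧ j.val + 1 = k) ∨ (j.val = 0 ∧ i.val + 1 = k)) then ε
    else 0
  symm i j := by simp only [or_comm, ne_comm]
  irrefl i := by simp

/-- Disjoint union of `G` and `H` with one additional positive edge, joining `v` and `u`. -/
def bridge {V W : Type*} [DecidableEq V] [DecidableEq W]
    (G : SignedGraph V) (v : V) (H : SignedGraph W) (u : W) : SignedGraph (V ⊕ W) where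
  sgn
    | .inl i, .inl j => G.sgn i j
    | .inr i, .inr j => H.sgn i j
    | .inl i, .inr j => if i = v ∧ j = u then 1 else 0
    | .inr i, .inl j => if j = v ∧ i = u then 1 else 0
  symm := by
    rintro (i | i) (j | j)
    · exact G.symm i j
    · rfl
    · rfl
    · exact H.symm i j
  irrefl := by
    rintro (i | i)
    · exact G.irrefl i
    · exact H.irrefl i

/-- Attach a (pendant) path with `n` new vertices at `v`: the first vertex of a new path `P_n` is
joined to `v` by a positive edge (nothing happens for `n = 0`). -/
def attachPath {V : Type*} [DecidableEq V] (G : SignedGraph V) (v : V) (n : ℕ) :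
    SignedGraph (V ⊕ Fin n) where
  sgn
    | .inl i, .inl j => G.sgn i j
    | .inr i, .inr j => (path n).sgn i j
    | .inl i, .inr j => if i = v ∧ j.val = 0 then 1 else 0
    | .inr i, .inl j => if j = v ∧ i.val = 0 then 1 else 0
  symm := by
    rintro (i | i) (j | j)
    · exact G.symm i j
    · rfl
    · rfl
    · exact (path n).symm i j
  irrefl := by
    rintro (i | i)
    · exact G.irrefl i
    · exact (path n).irrefl i

/-- The end of a path with `n` vertices attached at `v` (it is `v` itself if `n = 0`). -/
def tip {V : Type*} (v : V) : (n : ℕ) → V ⊕ Fin n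
  | 0 => .inl v
  | n + 1 => .inr (Fin.last n)

/-- Add one new vertex `none`, whose edges to the old vertices have the signs prescribed by `f`. -/
def addVertex {V : Type*} (G : SignedGraph V) (f : V → SignType) : SignedGraph (Option V) where
  sgn
    | some i, some j => G.sgn i j
    | some i, none => f i
    | none, some j => f j
    | none, none => 0
  symm := by
    rintro (_ | i) (_ | j)
    · rfl
    · rfl
    · rfl
    · exact G.symm i j
  irrefl := by
    rintro (_ | i)
    · rfl
    · exact G.irrefl i

/-! ### The infinite families of the first kind -/

/-- `𝒞_k^{1,k/2+1}`: an unbalanced `k`-cycle with one pendant edge at each of two opposite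
vertices. -/
def oppositePendants (k : ℕ) (hk : 4 ≤ k) : SignedGraph ((Fin k ⊕ Fin 1) ⊕ Fin 1) :=
  ((cycle k (-1)).attachPath ⟨0, by omega⟩ 1).attachPath (.inl ⟨k / 2, by omega⟩) 1

/-- `Θ_{k-3,1,1}`: a balanced `k`-cycle (all edges positive) and one more vertex `none`, joined by a
positive and by a negative edge to the two neighbours of the vertex `0` of the cycle. -/
def theta (k : ℕ) : SignedGraph (Option (Fin k)) :=
  (cycle k 1).addVertex fun i => if i.val = 1 then 1 else if i.val + 1 = k then -1 else 0

/-- `G_0^k`: `Θ_{k-3,1,1}` with a pendant edge at the vertex outside the `k`-cycle. -/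
def graphG0 (k : ℕ) : SignedGraph (Option (Fin k) ⊕ Fin 1) :=
  (theta k).attachPath none 1

/-- `U_6^{n₁,n₂}`: an unbalanced 6-cycle with paths of `n₁` and of `n₂` vertices attached at two
opposite vertices. -/
def graphU6 (n₁ n₂ : ℕ) : SignedGraph ((Fin 6 ⊕ Fin n₁) ⊕ Fin n₂) :=
  ((cycle 6 (-1)).attachPath 0 n₁).attachPath (.inl 3) n₂

/-- `𝒞_4[n₁,n₂,n₃,n₄]`: an unbalanced 4-cycle with paths of `n₁`, `n₂`, `n₃`, `n₄` vertices attached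
at its four consecutive vertices. -/
def graphC4 (n₁ n₂ n₃ n₄ : ℕ) :
    SignedGraph ((((Fin 4 ⊕ Fin n₁) ⊕ Fin n₂) ⊕ Fin n₃) ⊕ Fin n₄) :=
  ((((cycle 4 (-1)).attachPath 0 n₁).attachPath (.inl 1) n₂).attachPath
    (.inl (.inl 2)) n₃).attachPath (.inl (.inl (.inl 3))) n₄

/-- `S_1^n`: `Θ_{3,1,1}` (7 vertices) with a path of `n - 7` vertices attached at the vertex outside
the balanced 6-cycle. -/
def graphS1 (n : ℕ) : SignedGraph (Option (Fin 6) ⊕ Fin (n - 7)) :=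
  (theta 6).attachPath none (n - 7)

/-- The 9-vertex signed graph `S_2^9`: an unbalanced 6-cycle `0, …, 5`, a vertex `6` joined to
`0, 2, 4`, and a path `0, 7, 8, 6`, such that all four 4-cycles
`0126`, `2346`, `4506`, `0786` are unbalanced. -/
def graphS2core : SignedGraph (Fin 9) :=
  ofEdges 9 [(0, 1), (1, 2), (2, 3), (3, 4), (4, 5), (0, 6), (4, 6), (0, 7), (6, 8)]
    [(0, 5), (2, 6), (7, 8)]

/-- `S_2^n`: the signed graph `S_2^9` with a path of `n - 9` vertices attached at the vertex `3`,
which is the vertex of the 6-cycle opposite to `0`. -/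
def graphS2 (n : ℕ) : SignedGraph (Fin 9 ⊕ Fin (n - 9)) :=
  graphS2core.attachPath 3 (n - 9)

/-- Membership in the infinite families `𝒞_k^{1,k/2+1}` (`k` even), `G_0^k` (`k ≥ 12` even),
`U_6^{n₁,n₂}` (`n₁, n₂ ≥ 1`), `𝒞_4[n₁,1,n₃,1]` (`n₁, n₃ ≥ 1`), `S_1^n` (`n ≥ 8`) and `S_2^n`
(`n ≥ 10`), up to switching isomorphism. -/
def InFamilyIII {V : Type*} (G : SignedGraph V) : Prop :=
  (∃ (k : ℕ) (hk : 4 ≤ k), Even k ∧ G.SwitchingIso (oppositePendants k hk)) ∨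
  (∃ k : ℕ, 12 ≤ k ∧ Even k ∧ G.SwitchingIso (graphG0 k)) ∨
  (∃ n₁ n₂ : ℕ, 1 ≤ n₁ ∧ 1 ≤ n₂ ∧ G.SwitchingIso (graphU6 n₁ n₂)) ∨
  (∃ n₁ n₃ : ℕ, 1 ≤ n₁ ∧ 1 ≤ n₃ ∧ G.SwitchingIso (graphC4 n₁ 1 n₃ 1)) ∨
  (∃ n : ℕ, 8 ≤ n ∧ G.SwitchingIso (graphS1 n)) ∨
  (∃ n : ℕ, 10 ≤ n ∧ G.SwitchingIso (graphS2 n))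

/-! ### The infinite families of the second kind -/

/-- The signed graph `T'''_{2s}` with the `2s - 2` vertices `v_1, …, v_s, u_2, …, u_{s-1}`; here
`.inl i` is `v_{i+1}` and `.inr j` is `u_{j+2}`. The edges are `v_i v_{i+1}` (positive),
`u_i u_{i+1}` (negative), `v_i u_{i+1}` (positive) and `u_i v_{i+1}` (negative). -/
def strip (s : ℕ) : SignedGraph (Fin s ⊕ Fin (s - 2)) where
  sgn
    | .inl i, .inl j => if i.val + 1 = j.val ∨ j.val + 1 = i.val then 1 else 0
    | .inr i, .inr j => if i.val + 1 = j.val ∨ j.val + 1 = i.val then -1 else 0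
    | .inl i, .inr j => if i.val = j.val then 1 else if i.val = j.val + 2 then -1 else 0
    | .inr j, .inl i => if i.val = j.val then 1 else if i.val = j.val + 2 then -1 else 0
  symm := by
    rintro (i | i) (j | j)
    · simp only [or_comm]
    · rfl
    · rfl
    · simp only [or_comm]
  irrefl := by
    rintro (i | i) <;> simp

/-- `[G, v, s, u, H]`: the disjoint union of `G`, `T'''_{2s}` and `H` with two additional positive
edges, one joining `v` to the first end `v_1` and one joining `u` to the last end `v_s` of
`T'''_{2s}`. -/
def stripJoin {V W : Type*} [DecidableEq V] [DecidableEq W] (G : SignedGraph V) (v : V)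
    (s : ℕ) (hs : 3 ≤ s) (u : W) (H : SignedGraph W) :
    SignedGraph ((V ⊕ (Fin s ⊕ Fin (s - 2))) ⊕ W) :=
  (G.bridge v (strip s) (.inl ⟨0, by omega⟩)).bridge (.inr (.inl ⟨s - 1, by omega⟩)) H u

/-- `Θ_{2,2,0}`: the `2 × 3` grid with rows `0, 1, 2` and `3, 4, 5` in which both 4-cycles are
unbalanced. -/
def domino : SignedGraph (Fin 6) :=
  ofEdges 6 [(0, 1), (1, 2), (3, 4), (4, 5), (0, 3), (2, 5)] [(1, 4)]

/-- Three unbalanced 4-cycles `0143`, `1254`, `4576` in the shape of the letter L. -/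
def tromino : SignedGraph (Fin 8) :=
  ofEdges 8 [(0, 1), (1, 2), (3, 4), (4, 5), (0, 3), (2, 5), (4, 6), (5, 7)] [(1, 4), (6, 7)]

/-- `G_4^{12}`: `tromino` with a path of 4 vertices attached at `0`. -/
def graphG4 : SignedGraph (Fin 8 ⊕ Fin 4) := tromino.attachPath 0 4

/-- `G_2^9`: `Θ_{2,2,0}` with a pendant edge at `4` and a path of 2 vertices attached at `0`. -/
def graphG2 : SignedGraph ((Fin 6 ⊕ Fin 1) ⊕ Fin 2) :=
  (domino.attachPath 4 1).attachPath (.inl 0) 2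

/-- `G_5^{10}`: an unbalanced 4-cycle with paths of 2 and of 4 vertices attached at two adjacent
vertices. -/
def graphG5 : SignedGraph ((Fin 4 ⊕ Fin 2) ⊕ Fin 4) :=
  ((cycle 4 (-1)).attachPath 0 2).attachPath (.inl 1) 4

/-- `T_{a,b,c}`: three paths with `a`, `b` and `c` edges with one end vertex in common. -/
def graphT (a b c : ℕ) : SignedGraph (((Fin 1 ⊕ Fin a) ⊕ Fin b) ⊕ Fin c) :=
  (((path 1).attachPath 0 a).attachPath (.inl 0) b).attachPath (.inl (.inl 0)) c

/-- `Q'_{a,b}`: an unbalanced 4-cycle with a path of `a` vertices, a pendant edge, and a path of `b`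
vertices attached at three consecutive vertices. -/
def graphQ' (a b : ℕ) : SignedGraph (((Fin 4 ⊕ Fin a) ⊕ Fin 1) ⊕ Fin b) :=
  (((cycle 4 (-1)).attachPath 0 a).attachPath (.inl 1) 1).attachPath (.inl (.inl 2)) b

end SignedGraph

/-- A signed graph with a distinguished vertex. -/
structure RootedSignedGraph where
  V : Type
  [dec : DecidableEq V]
  graph : SignedGraph V
  root : V

attribute [instance] RootedSignedGraph.dec

namespace SignedGraph

/-- The admissible end pieces `(G_4^{12}, v_{12})`, `(G_2^9, v_9)`, `(T_{a,1,a-1}, v_{a-1})`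
(`a ≥ 3`), `(Q'_{n,n}, v_n)` (`n ≥ 1`), `(G_5^{10}, v_{10})` and `(P_4, v_2)`. In the first five the
root is the end of the path that is attached last, in `P_4` it is an inner vertex. -/
inductive IsEndPiece : RootedSignedGraph → Prop
  | g4 : IsEndPiece ⟨_, graphG4, tip 0 4⟩
  | g2 : IsEndPiece ⟨_, graphG2, tip (.inl 0) 2⟩
  | t (a : ℕ) (ha : 3 ≤ a) : IsEndPiece ⟨_, graphT a 1 (a - 1), tip (.inl (.inl 0)) (a - 1)⟩
  | q (n : ℕ) (hn : 1 ≤ n) : IsEndPiece ⟨_, graphQ' n n, tip (.inl (.inl 2)) n⟩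
  | g5 : IsEndPiece ⟨_, graphG5, tip (.inl 1) 4⟩
  | p4 : IsEndPiece ⟨_, path 4, 1⟩

/-- Membership in the family of all `[G, v, s, u, H]` with `s ≥ 3` and end pieces `(G, v)`, `(H, u)`
as above, up to switching isomorphism. -/
def InFamilyIV {V : Type*} (G : SignedGraph V) : Prop :=
  ∃ (L R : RootedSignedGraph) (s : ℕ) (hs : 3 ≤ s), IsEndPiece L ∧ IsEndPiece R ∧
    G.SwitchingIso (L.graph.stripJoin L.root s hs R.root R.graph)

end SignedGraph

/-- The constant `λ* = √(2 + √5)`. -/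
noncomputable def lambdaStar : ℝ := √(2 + √5)

/-! Every graph in the families is bipartite, so its spectrum is symmetric about 0 and ρ < λ*
follows once λ*·1 - A is positive definite (`rho_lt_lambdaStar`). Both properties survive
relabelling and switching, so only the model graphs have to be treated.

Put ψ = (√5 - 1)/2, so that λ*²ψ³ = 1. Eliminating an attached path from its far end by Schur
complements amounts to subtracting λ*·r_n from the diagonal entry at the attachment vertex, where
r_{n+1}(1 - r_n) = ψ³. This Möbius recursion has the fixed points ψ² and ψ and is solved explicitly
by `ratio`. A free end means r_0 = 0, that is c = ψ; then every r_n lies below ψ², which is why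
paths of arbitrary length are allowed. The elimination is `PosForm.attachPath_tip`.

In the coordinates V_i - U_i and V_i + U_i the strip falls apart into disjoint edges (`strip_form`).
Hence its two ends do not interact, and each of them costs the adjacent end piece a weight 1/√5 at
the root, whatever s ≥ 3 is (`PosForm.stripJoin`). Starting the recursion from r_0 = 1/√5, that is c
= -ψ², carries this weight along the path that ends in the root.

What remains is a core with a few diagonal weights. Long even cycles are folded along a reflection
and bounded by telescoping sums of squares (`cycle_posForm`, `theta_posForm`). Fixed small cores
have explicit LDLᵀ decompositions over ℚ(ψ). For T_{a,1,a-1} and Q'_{n,n} the weights of the two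
long paths are functions of the same power of ψ and are compared directly. -/

namespace SignedGraph

/-- The signs `sgn i j` are nonzero only between the two classes of a partition. -/
def IsBipartite {V : Type*} (G : SignedGraph V) : Prop :=
  ∃ c : V → Bool, ∀ i j, G.sgn i j ≠ 0 → c i ≠ c j

/-- The quadratic form of the adjacency matrix. -/
def adjForm {V : Type*} [Fintype V] (G : SignedGraph V) (x : V → ℝ) : ℝ :=
  ∑ i, ∑ j, ((G.sgn i j : SignType) : ℝ) * x i * x j

/-- The matrix `λ* (1 - diag a) - A(G)` is positive definite. -/
def PosForm {V : Type*} [Fintype V] (G : SignedGraph V) (a : V → ℝ) : Prop :=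
  ∀ x : V → ℝ, x ≠ 0 → G.adjForm x < lambdaStar * ∑ i, (1 - a i) * x i ^ 2

theorem lambdaStar_sq : lambdaStar ^ 2 = 2 + √5 := by
  rw [lambdaStar, Real.sq_sqrt (by positivity)]

theorem lambdaStar_pos : 0 < lambdaStar := by
  rw [lambdaStar]; positivity

/-! ### Reduction of the spectral bound to positive definiteness -/

section spectrum

variable {V W : Type*} [Fintype V] [Fintype W]

/-- Testing the form on an eigenvector bounds μ from above; testing it on the same vector with the
signs reversed on one colour class, which negates the form, bounds -μ. -/
theorem abs_lt_of_mulVec_eq {G : SignedGraph V} (hb : G.IsBipartite) (hp : G.PosForm 0)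
    {μ : ℝ} {x : V → ℝ} (hx : x ≠ 0) (h : G.adjMatrix.mulVec x = μ • x) : |μ| < lambdaStar := by
  obtain ⟨c, hc⟩ := hb
  have hi : ∀ i, ∑ j, ((G.sgn i j : SignType) : ℝ) * x j = μ * x i := fun i => congrFun h i
  have hsq : 0 < ∑ i, x i ^ 2 := by
    obtain ⟨i, hi⟩ := Function.ne_iff.1 hx
    exact Finset.sum_pos' (fun i _ => sq_nonneg _) ⟨i, Finset.mem_univ _, by
      have : x i ≠ 0 := hi
      positivity⟩
  have h1 : G.adjForm x = μ * ∑ i, x i ^ 2 := by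
    rw [adjForm, Finset.mul_sum]
    refine Finset.sum_congr rfl fun i _ => ?_
    rw [show μ * x i ^ 2 = (μ * x i) * x i by ring, ← hi, Finset.sum_mul]
    exact Finset.sum_congr rfl fun j _ => by ring
  let σ : V → ℝ := fun i => if c i then 1 else -1
  have hσ : ∀ i, σ i ^ 2 = 1 := fun i => by simp only [σ]; split_ifs <;> norm_num
  have h2 : G.adjForm (fun i => σ i * x i) = -G.adjForm x := by
    simp only [adjForm, ← Finset.sum_neg_distrib]
    refine Finset.sum_congr rfl fun i _ => Finset.sum_congr rfl fun j _ => ?_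
    by_cases hs : G.sgn i j = 0
    · simp [hs]
    · have := hc i j hs
      have : σ i * σ j = -1 := by
        simp only [σ]
        cases hci : c i <;> cases hcj : c j <;> simp_all
      linear_combination ((G.sgn i j : SignType) : ℝ) * x i * x j * this
  have hx' : (fun i => σ i * x i) ≠ 0 := by
    intro h0
    apply hx
    ext i
    have := congrFun h0 i
    simp only [Pi.zero_apply] at this ⊢
    linear_combination σ i * this - x i * hσ i
  have p1 := hp x hx
  have p2 := hp _ hx'
  simp only [Pi.zero_apply, sub_zero, one_mul, mul_pow, hσ] at p1 p2
  rw [h2] at p2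
  rw [h1] at p1 p2
  rw [abs_lt]
  constructor
  · nlinarith
  · exact lt_of_mul_lt_mul_right p1 hsq.le

theorem rho_lt_lambdaStar [DecidableEq V] {G : SignedGraph V} (hb : G.IsBipartite)
    (hp : G.PosForm 0) : G.rho < lambdaStar := by
  have key : ∀ i, |G.adjMatrix_isHermitian.eigenvalues i| < lambdaStar := fun i => by
    refine abs_lt_of_mulVec_eq hb hp ?_ (G.adjMatrix_isHermitian.mulVec_eigenvectorBasis i)
    intro h0
    apply (G.adjMatrix_isHermitian.eigenvectorBasis).toBasis.ne_zero i
    ext j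
    simpa using congrFun h0 j
  rw [rho]
  cases isEmpty_or_nonempty V
  -- With no vertices the supremum is over the empty family and equals 0 by convention.
  · rw [Real.iSup_of_isEmpty]; exact lambdaStar_pos
  · obtain ⟨i, hi⟩ := exists_eq_ciSup_of_finite
      (f := fun i => |G.adjMatrix_isHermitian.eigenvalues i|)
    rw [← hi]; exact key i

theorem SwitchingIso.isBipartite {V W : Type*} {G : SignedGraph V} {H : SignedGraph W}
    (h : G.SwitchingIso H) (hb : H.IsBipartite) : G.IsBipartite := by
  obtain ⟨S, e, he⟩ := h
  obtain ⟨c, hc⟩ := hb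
  refine ⟨c ∘ e, fun i j hij => hc _ _ fun h0 => hij ?_⟩
  rw [he, switch]
  simp [h0]

/-- Switching isomorphism conjugates the matrix by a permutation and a ±1 diagonal matrix, which
changes neither definiteness nor the norm. -/
theorem SwitchingIso.posForm {G : SignedGraph V} {H : SignedGraph W} (h : G.SwitchingIso H)
    (hp : H.PosForm 0) : G.PosForm 0 := by
  classical
  obtain ⟨S, e, he⟩ := h
  intro x hx
  let σ : W → ℝ := fun i => if i ∈ S then 1 else -1
  have hσ : ∀ i, σ i ^ 2 = 1 := fun i => by simp only [σ]; split_ifs <;> norm_num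
  have h1 : H.adjForm (fun i => σ i * x (e.symm i)) = G.adjForm x := by
    simp only [adjForm]
    rw [← e.sum_comp]
    refine Finset.sum_congr rfl fun i _ => ?_
    rw [← e.sum_comp]
    refine Finset.sum_congr rfl fun j _ => ?_
    rw [he, switch]
    simp only [Equiv.symm_apply_apply, σ]
    by_cases h1 : e i ∈ S <;> by_cases h2 : e j ∈ S <;> simp [h1, h2, SignType.coe_neg]
  have := hp (fun i => σ i * x (e.symm i)) (by
    intro h0
    apply hx
    ext i
    have := congrFun h0 (e i)
    simp only [Pi.zero_apply, Equiv.symm_apply_apply] at this ⊢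
    linear_combination σ (e i) * this - x i * hσ (e i))
  rw [h1, ← e.sum_comp] at this
  simpa [mul_pow, hσ] using this

theorem SwitchingIso.rho_lt [DecidableEq V] {G : SignedGraph V} {H : SignedGraph W}
    (h : G.SwitchingIso H) (hb : H.IsBipartite) (hp : H.PosForm 0) : G.rho < lambdaStar :=
  rho_lt_lambdaStar (h.isBipartite hb) (h.posForm hp)

end spectrum

/-! ### Bipartiteness of the building blocks -/

theorem IsBipartite.attachPath {V : Type*} [DecidableEq V] {G : SignedGraph V}
    (hb : G.IsBipartite) (v : V) (n : ℕ) : (G.attachPath v n).IsBipartite := by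
  obtain ⟨c, hc⟩ := hb
  refine ⟨Sum.elim c fun j => if Even j.val then !c v else c v, ?_⟩
  rintro (i | i) (j | j) h
  · exact hc i j h
  · simp only [SignedGraph.attachPath, ne_eq, ite_eq_right_iff, one_ne_zero, imp_false,
    not_not] at h
    simp [h]
  · simp only [SignedGraph.attachPath, ne_eq, ite_eq_right_iff, one_ne_zero, imp_false,
    not_not] at h
    simp [h]
  · simp only [SignedGraph.attachPath, path, ne_eq, ite_eq_right_iff, one_ne_zero, imp_false,
      not_not] at h
    have hne : ¬(Even i.val ↔ Even j.val) := by
      simp only [Nat.even_iff]; omega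
    by_cases h2 : Even j.val <;> by_cases h3 : Even i.val <;> simp_all

theorem IsBipartite.bridge {V W : Type*} [DecidableEq V] [DecidableEq W] {G : SignedGraph V}
    {H : SignedGraph W} (hG : G.IsBipartite) (hH : H.IsBipartite) (v : V) (u : W) :
    (G.bridge v H u).IsBipartite := by
  obtain ⟨c, hc⟩ := hG
  obtain ⟨d, hd⟩ := hH
  refine ⟨Sum.elim c fun j => if d u = c v then !d j else d j, ?_⟩
  rintro (i | i) (j | j) h
  · exact hc i j h
  · simp only [SignedGraph.bridge, ne_eq, ite_eq_right_iff, one_ne_zero, imp_false, not_not] at h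
    by_cases h2 : d u = c v <;> simp [h, h2]
    exact fun h3 => h2 h3.symm
  · simp only [SignedGraph.bridge, ne_eq, ite_eq_right_iff, one_ne_zero, imp_false, not_not] at h
    by_cases h2 : d u = c v <;> simp [h, h2]
  · have := hd i j h
    by_cases h2 : d u = c v <;> simpa [h2] using this

theorem isBipartite_path (n : ℕ) : (path n).IsBipartite := by
  refine ⟨fun i => decide (Even i.val), fun i j h => ?_⟩
  simp only [path, ne_eq, ite_eq_right_iff, one_ne_zero, imp_false, not_not] at h
  simp only [ne_eq, decide_eq_decide, Nat.even_iff]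
  omega

theorem even_iff_of_cycle_sgn_ne_zero {k : ℕ} (hk : Even k) {ε : SignType} {i j : Fin k}
    (h : (cycle k ε).sgn i j ≠ 0) : decide (Even i.val) ≠ decide (Even j.val) := by
  have key : (i.val + 1 = j.val ∨ j.val + 1 = i.val) ∨
      (i.val = 0 ∧ j.val + 1 = k) ∨ (j.val = 0 ∧ i.val + 1 = k) := by
    by_contra hc
    push Not at hc
    apply h
    simp only [cycle]
    rw [if_neg (by omega), if_neg (by omega)]
  simp only [ne_eq, decide_eq_decide, Nat.even_iff] at hk ⊢
  omega

theorem isBipartite_cycle {k : ℕ} (hk : Even k) (ε : SignType) : (cycle k ε).IsBipartite :=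
  ⟨fun i => decide (Even i.val), fun _ _ h => even_iff_of_cycle_sgn_ne_zero hk h⟩

theorem isBipartite_theta {k : ℕ} (hk : Even k) : (theta k).IsBipartite := by
  have hn : ∀ i : Fin k, (if i.val = 1 then (1 : SignType) else if i.val +
    1 = k then -1 else 0) ≠ 0 →
      decide (Even i.val) = false := fun i h => by
    have : i.val = 1 ∨ i.val + 1 = k := by
      by_contra hc
      push Not at hc
      simp [hc] at h
    simp only [decide_eq_false_iff_not, Nat.even_iff] at hk ⊢
    omega
  refine ⟨fun i => i.elim true fun i => decide (Even i.val), ?_⟩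
  rintro (_ | i) (_ | j) h
  · exact absurd rfl h
  · exact fun h0 => Bool.noConfusion (h0.trans (hn j h))
  · exact fun h0 => Bool.noConfusion (h0.symm.trans (hn i h))
  · exact even_iff_of_cycle_sgn_ne_zero hk h

theorem isBipartite_strip (s : ℕ) : (strip s).IsBipartite := by
  refine ⟨Sum.elim (fun i => decide (Even i.val)) fun i => decide (Even (i.val + 1)), ?_⟩
  rintro (i | i) (j | j) h <;>
  simp only [Sum.elim_inl, Sum.elim_inr, ne_eq, decide_eq_decide, Nat.even_iff]
  · have : i.val + 1 = j.val ∨ j.val + 1 = i.val := by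
      by_contra hc; simp [strip, hc] at h
    omega
  · have : i.val = j.val ∨ i.val = j.val + 2 := by
      by_contra hc; push Not at hc; simp [strip, hc] at h
    omega
  · have : j.val = i.val ∨ j.val = i.val + 2 := by
      by_contra hc; push Not at hc; simp [strip, hc] at h
    omega
  · have : i.val + 1 = j.val ∨ j.val + 1 = i.val := by
      by_contra hc; simp [strip, hc] at h
    omega

theorem isBipartite_domino : domino.IsBipartite :=
  ⟨![true, false, true, false, true, false], by decide⟩

theorem isBipartite_tromino : tromino.IsBipartite :=
  ⟨![true, false, true, false, true, false, false, true], by decide⟩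

theorem isBipartite_graphS2core : graphS2core.IsBipartite :=
  ⟨![true, false, true, false, true, false, false, false, true], by decide⟩

/-! ### Elimination of attached paths -/

/-- The positive root of `X² + X - 1`. -/
noncomputable def psi : ℝ := (√5 - 1) / 2

theorem psi_sq : psi ^ 2 = 1 - psi := by
  have := Real.sq_sqrt (show (0 : ℝ) ≤ 5 by norm_num)
  rw [psi]; linear_combination this / 4

theorem psi_bounds : 0.61803 < psi ∧ psi < 0.61804 := by
  have h1 : (2.23606 : ℝ) < √5 := Real.lt_sqrt_of_sq_lt (by norm_num)
  have h2 : √5 < 2.23607 := by rw [Real.sqrt_lt' (by norm_num)]; norm_num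
  rw [psi]; constructor <;> linarith

theorem psi_pos : 0 < psi := by linarith [psi_bounds.1]

theorem lambdaStar_sq' : lambdaStar ^ 2 = 3 + 2 * psi := by
  rw [lambdaStar_sq, psi]; ring

/-- Identifies ψ³ with 1/λ*². Through this identity and `psi_sq` the later computations take place
in ℚ(ψ). -/
theorem lambdaStar_sq_mul : lambdaStar ^ 2 * psi ^ 3 = 1 := by
  rw [lambdaStar_sq']; linear_combination (1 + psi + 2 * psi ^ 2) * psi_sq

/-- The diagonal weight that replaces an attached path with `n` vertices; the weight of the end of
the path depends on `c`. -/
noncomputable def ratio (c : ℝ) (n : ℕ) : ℝ :=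
  (psi ^ 2 - psi * (c * psi ^ n)) / (1 - c * psi ^ n)

theorem mul_psi_pow_lt_one {c : ℝ} (hc : c < 1) (n : ℕ) : c * psi ^ n < 1 := by
  have h1 : psi ^ n ≤ 1 := pow_le_one₀ psi_pos.le (by linarith [psi_bounds.2])
  have h2 : 0 < psi ^ n := pow_pos psi_pos n
  nlinarith

theorem ratio_lt_one {c : ℝ} (hc : c < 1) (n : ℕ) : ratio c n < 1 := by
  have h := mul_psi_pow_lt_one hc n
  rw [ratio, div_lt_one (by linarith), psi_sq]
  nlinarith [psi_bounds.1, psi_bounds.2]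

/-- One Schur complement step: a vertex with remaining pivot λ*(1 - r) passes the weight 1/(λ*²(1 -
r)) on to its neighbour. The fixed points ψ² and ψ diagonalise this Möbius map with multiplier ψ,
whence the dependence of `ratio` on c·ψⁿ alone. -/
theorem ratio_succ {c : ℝ} (hc : c < 1) (n : ℕ) :
    ratio c (n + 1) * (1 - ratio c n) = psi ^ 3 := by
  have h1 := mul_psi_pow_lt_one hc n
  have h2 := mul_psi_pow_lt_one hc (n + 1)
  rw [ratio, ratio, one_sub_div (by linarith), div_mul_div_comm, div_eq_iff
    (mul_ne_zero (by linarith) (by linarith)), pow_succ psi n, ← mul_assoc c]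
  generalize c * psi ^ n = z
  linear_combination -(psi ^ 2 * (1 - z) ^ 2) * psi_sq

theorem ratio_psi_zero : ratio psi 0 = 0 := by
  simp [ratio]; left; ring

theorem path_form_succ (n : ℕ) (y : Fin (n + 1) → ℝ) :
    (path (n + 1)).adjForm y = 2 * (∑ j : Fin n, if j.val = 0 then y 0 * y j.succ else 0) +
      (path n).adjForm (fun i => y i.succ) := by
  have h0 : ∀ j : Fin n, (path (n + 1)).sgn 0 j.succ = if j.val = 0 then 1 else 0 := fun j => by
    simp [path, eq_comm]
  have h1 : ∀ i j : Fin n, (path (n + 1)).sgn i.succ j.succ = (path n).sgn i j := fun i j => by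
    simp [path]
  simp only [adjForm, Fin.sum_univ_succ, (path (n + 1)).irrefl, h1,
    fun j => (path (n+1)).symm (Fin.succ j) 0,
    h0, Finset.sum_add_distrib, two_mul]
  have : ∀ j : Fin n, (((if j.val = 0 then 1 else 0 : SignType) : SignType) : ℝ) * y 0 * y j.succ
      = if j.val = 0 then y 0 * y j.succ else 0 := fun j => by split_ifs <;> simp
  have h' : ∀ j : Fin n, (((if j.val = 0 then 1 else 0 : SignType) : SignType) : ℝ) * y j.succ * y 0
      = if j.val = 0 then y 0 * y j.succ else 0 := fun j => by split_ifs <;> simp [mul_comm]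
  simp only [this, h', SignType.coe_zero, zero_mul, zero_add]
  ring

/-- The part of the quadratic form of a graph that comes from an attached path with values `y`, at
a vertex with value `c`; the end of the path has the weight `e`. -/
noncomputable def tailForm (e : ℝ) (n : ℕ) (c : ℝ) (y : Fin n → ℝ) : ℝ :=
  lambdaStar * ∑ i, y i ^ 2 - (path n).adjForm y - 2 * (∑ j, if j.val = 0 then c * y j else 0) -
    lambdaStar * (e * Sum.elim (fun _ => c) y (tip () n) ^ 2)

theorem tailForm_succ (e : ℝ) (n : ℕ) (c : ℝ) (y : Fin (n + 1) → ℝ) :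
    tailForm e (n + 1) c y =
      lambdaStar * y 0 ^ 2 - 2 * c * y 0 + tailForm e n (y 0) (fun i => y i.succ) := by
  have ht : Sum.elim (fun _ => c) y (tip () (n + 1)) =
      Sum.elim (fun _ => y 0) (fun i => y i.succ) (tip () n) := by
    cases n <;> rfl
  rw [tailForm, tailForm, path_form_succ, ht, Fin.sum_univ_succ, Fin.sum_univ_succ (fun j :
    Fin (n+1) => if j.val = 0 then c * y j else 0)]
  simp
  ring

/-- Induction along the path, completing the square at its first vertex; `ratio_lt_one` makes the
pivot positive. For n = 0 the tip is the attachment vertex itself, so the end weight acts there and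
both terms cancel. -/
theorem tailForm_nonneg {c : ℝ} (hc : c < 1) (n : ℕ) (x : ℝ) (y : Fin n → ℝ) :
    0 ≤ tailForm (ratio c 0) n x y + lambdaStar * ratio c n * x ^ 2 := by
  induction n generalizing x with
  | zero => simp [tailForm, tip, adjForm]; linarith
  | succ n ih =>
    have h := ih (y 0) (fun i => y i.succ)
    rw [tailForm_succ]
    have h1 := ratio_lt_one hc n
    have h2 := ratio_succ hc n
    have hl := lambdaStar_pos
    have h3 : lambdaStar * ratio c (n + 1) * (lambdaStar * (1 - ratio c n)) = 1 := by
      linear_combination lambdaStar ^ 2 * h2 + lambdaStar_sq_mul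
    -- The minimiser in y 0 is x divided by the pivot λ*(1 - r_n), which by `h3` is λ*·r_{n+1}·x.
    have h4 : 0 ≤ (lambdaStar * (1 - ratio c n)) * (y 0 - lambdaStar * ratio c (n + 1) * x) ^ 2 :=
      mul_nonneg (mul_nonneg hl.le (by linarith)) (sq_nonneg _)
    linear_combination h + h4 + (lambdaStar * ratio c (n + 1) * x ^ 2 - 2 * x * y 0) * h3

theorem tailForm_pos {c : ℝ} (hc : c < 1) (n : ℕ) (y : Fin n → ℝ) (hy : y ≠ 0) :
    0 < tailForm (ratio c 0) n 0 y := by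
  induction n with
  | zero => exact absurd (Subsingleton.elim _ _) hy
  | succ n ih =>
    rw [tailForm_succ]
    have hn := tailForm_nonneg hc n (y 0) (fun i => y i.succ)
    have h1 := ratio_lt_one hc n
    have hl := lambdaStar_pos
    by_cases h0 : y 0 = 0
    · have hy' : (fun i : Fin n => y i.succ) ≠ 0 := fun h => hy (by
        ext i
        refine Fin.cases h0 (fun j => congrFun h j) i)
      have := ih _ hy'
      rw [h0]; linarith
    · have : 0 < lambdaStar * (1 - ratio c n) * y 0 ^ 2 :=
        mul_pos (mul_pos hl (by linarith)) (by positivity)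
      linarith

theorem adjForm_attachPath {V : Type*} [Fintype V] [DecidableEq V] (G : SignedGraph V) (v : V)
    (n : ℕ) (x : V ⊕ Fin n → ℝ) :
    (G.attachPath v n).adjForm x = G.adjForm (x ∘ .inl) + (path n).adjForm (x ∘ .inr) +
      2 * ∑ j : Fin n, if j.val = 0 then x (.inl v) * x (.inr j) else 0 := by
  have h1 : ∀ i (j : Fin n), (((G.attachPath v n).sgn (.inl i) (.inr j) : SignType) : ℝ) *
      x (.inl i) * x (.inr j) =
        if i = v then (if j.val = 0 then x (.inl v) * x (.inr j) else 0) else 0 := fun i j => by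
    by_cases h : i = v <;> by_cases h' : j.val = 0 <;> simp [attachPath, h, h']
  have h2 : ∀ i (j : Fin n), (((G.attachPath v n).sgn (.inr j) (.inl i) : SignType) : ℝ) *
      x (.inr j) * x (.inl i) =
        if i = v then (if j.val = 0 then x (.inl v) * x (.inr j) else 0) else 0 := fun i j => by
    rw [(G.attachPath v n).symm, ← h1]; ring
  have h3 : ∑ i : V, ∑ j : Fin n,
      (if i = v then (if j.val = 0 then x (.inl v) * x (.inr j) else 0) else 0) =
      ∑ j : Fin n, if j.val = 0 then x (.inl v) * x (.inr j) else 0 := by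
    rw [Finset.sum_comm]; simp
  simp only [adjForm, Fintype.sum_sum_type, h1, h2, Finset.sum_add_distrib, h3]
  rw [Finset.sum_comm (f := fun (j : Fin n) (i : V) => if i = v then _ else _), h3]
  simp only [attachPath, Function.comp]
  ring

theorem sum_weight_add_single {V : Type*} [Fintype V] [DecidableEq V] (a x : V → ℝ) (v : V)
    (r : ℝ) : ∑ i, (1 - (a + Pi.single v r : V → ℝ) i) * x i ^ 2 =
      ∑ i, (1 - a i) * x i ^ 2 - r * x v ^ 2 := by
  have : ∀ i, (1 - (a + Pi.single v r : V → ℝ) i) * x i ^ 2 =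
      (1 - a i) * x i ^ 2 - if i = v then r * x v ^ 2 else 0 := fun i => by
    by_cases h : i = v
    · subst h; simp; ring
    · simp [h]
  simp only [this, Finset.sum_sub_distrib, Finset.sum_ite_eq', Finset.mem_univ, if_true]

/-- A weight at the end of the path is traded for a weight at the attachment vertex. Strictness
comes from the core if the vector is nonzero there, and otherwise from the path alone. -/
theorem PosForm.attachPath_tip {V : Type*} [Fintype V] [DecidableEq V] {G : SignedGraph V} {v : V}
    {n : ℕ} {a : V → ℝ} {c : ℝ} (hc : c < 1) (h : G.PosForm (a + Pi.single v (ratio c n))) :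
    (G.attachPath v n).PosForm (Sum.elim a 0 + Pi.single (tip v n) (ratio c 0)) := by
  intro x hx
  rw [adjForm_attachPath]
  have ht : x (tip v n) = Sum.elim (fun _ => x (.inl v)) (x ∘ .inr) (tip () n) := by
    cases n <;> rfl
  rw [sum_weight_add_single, ht]
  simp only [Fintype.sum_sum_type, Sum.elim_inl, Sum.elim_inr, Pi.zero_apply, sub_zero, one_mul]
  have key : G.adjForm (x ∘ .inl) + lambdaStar * ratio c n * x (.inl v) ^ 2 <
      lambdaStar * ∑ i, (1 - a i) * x (.inl i) ^ 2 +
      (tailForm (ratio c 0) n (x (.inl v)) (x ∘ .inr) +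
        lambdaStar * ratio c n * x (.inl v) ^ 2) := by
    by_cases h0 : x ∘ Sum.inl = 0
    · have h1 : ∀ i, x (.inl i) = 0 := fun i => congrFun h0 i
      have h2 : x ∘ Sum.inr ≠ 0 := fun h2 => hx (by
        ext (i | i)
        · exact h1 i
        · exact congrFun h2 i)
      have := tailForm_pos hc n _ h2
      simp only [h0, h1]
      simpa [adjForm] using this
    · have h1 := h _ h0
      rw [sum_weight_add_single] at h1
      have h2 := tailForm_nonneg hc n (x (.inl v)) (x ∘ .inr)
      simp only [Function.comp_apply] at h1
      linarith
  rw [tailForm] at key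
  simp only [Function.comp_apply] at key ⊢
  linarith

theorem PosForm.attachPath {V : Type*} [Fintype V] [DecidableEq V] {G : SignedGraph V} {v : V}
    {n : ℕ} {a : V → ℝ} (h : G.PosForm (a + Pi.single v (ratio psi n))) :
    (G.attachPath v n).PosForm (Sum.elim a 0) := by
  have := h.attachPath_tip (by linarith [psi_bounds.2])
  simpa [ratio_psi_zero] using this

theorem lambdaStar_gt_two : 2 < lambdaStar := by
  have := lambdaStar_sq'
  nlinarith [psi_bounds.1, lambdaStar_pos]

/-! ### The strip -/

/-- The contribution of one edge of weight two between two vertices that have half the weight. -/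
noncomputable def edgeForm (a b : ℝ) : ℝ := lambdaStar / 2 * (a ^ 2 + b ^ 2) - 2 * a * b

theorem edgeForm_ge (a b : ℝ) : (lambdaStar / 2 - 1) * (a ^ 2 + b ^ 2) ≤ edgeForm a b := by
  rw [edgeForm]; linarith [sq_nonneg (a - b)]

theorem edgeForm_nonneg (a b : ℝ) : 0 ≤ edgeForm a b := by
  refine le_trans ?_ (edgeForm_ge a b)
  have := lambdaStar_gt_two
  exact mul_nonneg (by linarith) (by positivity)

theorem eq_zero_of_edgeForm {a b : ℝ} (h : edgeForm a b ≤ 0) : a = 0 ∧ b = 0 := by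
  have h1 := edgeForm_ge a b
  have := lambdaStar_gt_two
  have h2 : a ^ 2 + b ^ 2 ≤ 0 := by nlinarith [sq_nonneg a, sq_nonneg b]
  constructor <;> nlinarith [sq_nonneg a, sq_nonneg b]

theorem edgeForm_comm (a b : ℝ) : edgeForm a b = edgeForm b a := by
  rw [edgeForm, edgeForm]; ring

/-- Completing squares at the first layer of the strip. -/
theorem end_edgeForm_nonneg (c a b : ℝ) :
    0 ≤ edgeForm a b + lambdaStar / 2 * a ^ 2 - 2 * c * a + lambdaStar * (1 / √5) * c ^ 2 := by
  have hl := lambdaStar_pos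
  have h5 : 0 < √5 := by positivity
  -- Eliminating b leaves the pivot λ* - 2/λ* at a, which is √5/λ* because λ*² - 2 = √5; eliminating
  -- a then gives the constant 1/√5.
  have h1 : 0 ≤ lambdaStar / 2 * (b - 2 / lambdaStar * a) ^ 2 := by positivity
  have h2 : 0 ≤ √5 / lambdaStar * (a - lambdaStar / √5 * c) ^ 2 := by positivity
  have h3 : √5 / lambdaStar = lambdaStar - 2 / lambdaStar := by
    field_simp; linear_combination -lambdaStar_sq
  have e1 : lambdaStar / 2 * (b - 2 / lambdaStar * a) ^ 2 =
      lambdaStar / 2 * b ^ 2 - 2 * a * b + 2 / lambdaStar * a ^ 2 := by field_simp; ring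
  have e2 : √5 / lambdaStar * (a - lambdaStar / √5 * c) ^ 2 =
      √5 / lambdaStar * a ^ 2 - 2 * c * a + lambdaStar * (1 / √5) * c ^ 2 := by field_simp; ring
  rw [e1] at h1
  rw [e2, h3] at h2
  rw [edgeForm]
  linarith

theorem path_adjForm (n : ℕ) (f : ℕ → ℝ) :
    (path (n + 1)).adjForm (fun i => f i) = 2 * ∑ i ∈ Finset.range n, f i * f (i + 1) := by
  induction n generalizing f with
  | zero => simp [adjForm, path]
  | succ n ih =>
    have h := ih (fun i => f (i + 1))
    simp only [path_form_succ (n + 1), Fin.val_succ, h]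
    rw [Fin.sum_univ_succ, Finset.sum_range_succ']
    simp
    ring

/-- Expanding (V_i - U_i)(V_{i+1} + U_{i+1}) produces the four kinds of edges between consecutive
layers with exactly their signs. -/
theorem strip_adjForm {m : ℕ} (V U : ℕ → ℝ) (hU0 : U 0 = 0) (hU1 : U (m + 2) = 0) :
    (strip (m + 3)).adjForm (Sum.elim (fun i => V i) fun j => U (j + 1)) =
      2 * ∑ i ∈ Finset.range (m + 2), (V i - U i) * (V (i + 1) + U (i + 1)) := by
  have h1 := path_adjForm (m + 2) V
  have h2 := path_adjForm m fun i => U (i + 1)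
  have h3 : ∑ i : Fin (m + 3), ∑ j : Fin (m + 1),
      (((strip (m + 3)).sgn (.inl i) (.inr j) : SignType) : ℝ) * V i * U (j + 1) =
        ∑ j ∈ Finset.range (m + 1), (V j * U (j + 1) - U (j + 1) * V (j + 2)) := by
    rw [Finset.sum_comm, ← Fin.sum_univ_eq_sum_range]
    refine Finset.sum_congr rfl fun j _ => ?_
    have h : ∀ i : Fin (m + 3),
        (((strip (m + 3)).sgn (.inl i) (.inr j) : SignType) : ℝ) * V i * U (j + 1) =
        (if i = j.castLE (by omega) then V j * U (j + 1) else 0) -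
          (if i = ⟨j + 2, by omega⟩ then U (j + 1) * V (j + 2) else 0) := fun i => by
      by_cases hi : i.val = j.val
      · have hi' : ¬ i.val = j.val + 2 := by omega
        simp [strip, Fin.ext_iff, hi]
      · by_cases hi' : i.val = j.val + 2
        · simp [strip, Fin.ext_iff, hi', mul_comm]
        · simp [strip, Fin.ext_iff, hi, hi']
    simp [h, Finset.sum_sub_distrib]
  have h4 : ∑ j : Fin (m + 1), ∑ i : Fin (m + 3),
      (((strip (m + 3)).sgn (.inr j) (.inl i) : SignType) : ℝ) * U (j + 1) * V i =
        ∑ j ∈ Finset.range (m + 1), (V j * U (j + 1) - U (j + 1) * V (j + 2)) := by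
    rw [← h3, Finset.sum_comm]
    refine Finset.sum_congr rfl fun i _ => Finset.sum_congr rfl fun j _ => ?_
    rw [(strip (m + 3)).symm]; ring
  have h5 : ∑ i : Fin (m + 3), ∑ j : Fin (m + 3),
      (((strip (m + 3)).sgn (.inl i) (.inl j) : SignType) : ℝ) * V i * V j =
        (path (m + 3)).adjForm (fun i => V i) := rfl
  have h6 : ∑ i : Fin (m + 1), ∑ j : Fin (m + 1),
      (((strip (m + 3)).sgn (.inr i) (.inr j) : SignType) : ℝ) * U (i + 1) * U (j + 1) =
        -(path (m + 1)).adjForm (fun i => U (i + 1)) := by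
    simp only [adjForm, ← Finset.sum_neg_distrib]
    refine Finset.sum_congr rfl fun i _ => Finset.sum_congr rfl fun j _ => ?_
    by_cases h : i.val + 1 = j.val ∨ j.val + 1 = i.val <;> simp [strip, path, h]
  simp only [adjForm, Fintype.sum_sum_type, Sum.elim_inl, Sum.elim_inr, Finset.sum_add_distrib]
  erw [h3, h4, h5, h6, h1, h2]
  have e1 : ∑ i ∈ Finset.range (m + 2), V i * U (i + 1) =
      ∑ i ∈ Finset.range (m + 1), V i * U (i + 1) := by
    rw [Finset.sum_range_succ, hU1]; simp
  have e2 : ∑ i ∈ Finset.range (m + 2), U i * V (i + 1) =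
      ∑ i ∈ Finset.range (m + 1), U (i + 1) * V (i + 2) := by
    rw [Finset.sum_range_succ', hU0]; simp
  have e3 : ∑ i ∈ Finset.range (m + 2), U i * U (i + 1) =
      ∑ i ∈ Finset.range m, U (i + 1) * U (i + 1 + 1) := by
    rw [Finset.sum_range_succ, Finset.sum_range_succ', hU0, hU1]; simp
  have e4 : ∀ i, (V i - U i) * (V (i + 1) + U (i + 1)) = V i * V (i + 1) + V i * U (i + 1) -
      U i * V (i + 1) - U i * U (i + 1) := fun i => by ring
  simp only [e4, Finset.sum_add_distrib, Finset.sum_sub_distrib, e1, e2, e3]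
  ring

/-- Since (V - U)² + (V + U)² = 2V² + 2U², each layer splits into two independent coordinates, one
for the edge on each side. The end layers have only one such edge, which leaves half of the weight
of V at both ends. -/
theorem strip_form {s : ℕ} (hs : 3 ≤ s) (y : Fin s ⊕ Fin (s - 2) → ℝ) :
    ∃ V U : ℕ → ℝ, U 0 = 0 ∧ U (s - 1) = 0 ∧ (∀ i : Fin s, y (.inl i) = V i) ∧
      (∀ j : Fin (s - 2), y (.inr j) = U (j + 1)) ∧
      lambdaStar * ∑ i, y i ^ 2 - (strip s).adjForm y =
        ∑ i ∈ Finset.range (s - 1), edgeForm (V i - U i) (V (i + 1) + U (i + 1)) +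
          lambdaStar / 2 * (V 0 ^ 2 + V (s - 1) ^ 2) := by
  obtain ⟨m, rfl⟩ : ∃ m, s = m + 3 := ⟨s - 3, by omega⟩
  let V : ℕ → ℝ := fun i => if h : i < m + 3 then y (.inl ⟨i, h⟩) else 0
  -- The value 0 outside the range matters: it gives both end layers a fictitious partner u with
  -- value 0.
  let U : ℕ → ℝ := fun i => if h : 0 < i ∧ i < m + 2 then y (.inr ⟨i - 1, by omega⟩) else 0
  have hU0 : U 0 = 0 := by simp [U]
  have hU1 : U (m + 2) = 0 := by simp [U]
  have hV : ∀ i : Fin (m + 3), y (.inl i) = V i := fun i => by simp [V]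
  have hU : ∀ j : Fin (m + 1), y (.inr j) = U (j + 1) := fun j => by
    have : j.val + 1 < m + 2 := by omega
    simp [U]; omega
  clear_value V U
  refine ⟨V, U, hU0, hU1, hV, hU, ?_⟩
  obtain rfl : y = Sum.elim (fun i : Fin (m + 3) => V i) fun j : Fin (m + 1) => U (j + 1) := by
    ext (i | j)
    · exact hV i
    · exact hU j
  erw [strip_adjForm V U hU0 hU1]
  rw [Fintype.sum_sum_type]
  simp only [Sum.elim_inl, Sum.elim_inr]
  rw [Fin.sum_univ_eq_sum_range (fun i => V i ^ 2)]
  erw [Fin.sum_univ_eq_sum_range (fun i => U (i + 1) ^ 2) (m + 1)]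
  have f1 : ∑ i ∈ Finset.range (m + 2), (V (i + 1) + U (i + 1)) ^ 2 =
      ∑ i ∈ Finset.range (m + 2), (V i + U i) ^ 2 + V (m + 2) ^ 2 - V 0 ^ 2 := by
    have := Finset.sum_range_succ (fun i => (V i + U i) ^ 2) (m + 2)
    rw [Finset.sum_range_succ', hU0, hU1] at this
    linarith
  have f2 : ∑ i ∈ Finset.range (m + 1), U (i + 1) ^ 2 = ∑ i ∈ Finset.range (m + 2), U i ^ 2 := by
    rw [Finset.sum_range_succ' _ (m + 1), hU0]; simp
  have f3 : ∑ i ∈ Finset.range (m + 2), (V i + U i) ^ 2 +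
      ∑ i ∈ Finset.range (m + 2), (V i - U i) ^ 2 = 2 * ∑ i ∈ Finset.range (m + 2), V i ^ 2 +
        2 * ∑ i ∈ Finset.range (m + 2), U i ^ 2 := by
    simp only [Finset.mul_sum, ← Finset.sum_add_distrib]
    exact Finset.sum_congr rfl fun i _ => by ring
  have f4 : ∑ i ∈ Finset.range (m + 2), edgeForm (V i - U i) (V (i + 1) + U (i + 1)) =
      lambdaStar / 2 * (∑ i ∈ Finset.range (m + 2), (V i - U i) ^ 2 +
        ∑ i ∈ Finset.range (m + 2), (V (i + 1) + U (i + 1)) ^ 2) -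
      2 * ∑ i ∈ Finset.range (m + 2), (V i - U i) * (V (i + 1) + U (i + 1)) := by
    simp only [Finset.mul_sum, ← Finset.sum_add_distrib, ← Finset.sum_sub_distrib]
    exact Finset.sum_congr rfl fun i _ => by rw [edgeForm]; ring
  simp only [show m + 3 - 1 = m + 2 by omega]
  rw [f4, f1, f2, Finset.sum_range_succ _ (m + 2)]
  linear_combination -(lambdaStar / 2) * f3

theorem bridge_adjForm {V W : Type*} [Fintype V] [Fintype W] [DecidableEq V] [DecidableEq W]
    (G : SignedGraph V) (v : V) (H : SignedGraph W) (u : W) (x : V ⊕ W → ℝ) :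
    (G.bridge v H u).adjForm x = G.adjForm (x ∘ .inl) + H.adjForm (x ∘ .inr) +
      2 * (x (.inl v) * x (.inr u)) := by
  have h1 : ∀ i j, (((G.bridge v H u).sgn (.inl i) (.inr j) : SignType) : ℝ) *
      x (.inl i) * x (.inr j) =
        if j = u then (if i = v then x (.inl v) * x (.inr u) else 0) else 0 := fun i j => by
    by_cases h : i = v <;> by_cases h' : j = u <;> simp [bridge, h, h']
  have h2 : ∀ i j, (((G.bridge v H u).sgn (.inr j) (.inl i) : SignType) : ℝ) *
      x (.inr j) * x (.inl i) =
        if i = v then (if j = u then x (.inl v) * x (.inr u) else 0) else 0 := fun i j => by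
    by_cases h : i = v <;> by_cases h' : j = u <;> simp [bridge, h, h', mul_comm]
  simp only [adjForm, Fintype.sum_sum_type, h1, h2, Finset.sum_add_distrib,
    Finset.sum_ite_eq', Finset.mem_univ, if_true]
  simp only [bridge, Function.comp]
  ring

/-- For s ≥ 3 the first and the last decoupled edge are different, so each absorbs its own boundary
term; the edges between them only contribute nonnegative terms. -/
theorem strip_ends_nonneg {s : ℕ} (hs : 3 ≤ s) (a b : ℝ) (y : Fin s ⊕ Fin (s - 2) → ℝ) :
    0 ≤ lambdaStar * ∑ i, y i ^ 2 - (strip s).adjForm y - 2 * a * y (.inl ⟨0, by omega⟩) -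
      2 * b * y (.inl ⟨s - 1, by omega⟩) + lambdaStar * (1 / √5) * (a ^ 2 + b ^ 2) := by
  obtain ⟨V, U, hU0, hU1, hV, hU, h⟩ := strip_form hs y
  rw [h, hV, hV]
  obtain ⟨m, rfl⟩ : ∃ m, s = m + 3 := ⟨s - 3, by omega⟩
  simp only [show m + 3 - 1 = m + 1 + 1 by omega] at hU1 ⊢
  rw [Finset.sum_range_succ, Finset.sum_range_succ', hU0, hU1]
  have h1 := end_edgeForm_nonneg a (V 0) (V 1 + U 1)
  have h2 := end_edgeForm_nonneg b (V (m + 1 + 1)) (V (m + 1) - U (m + 1))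
  have h3 : 0 ≤ ∑ i ∈ Finset.range m,
      edgeForm (V (i + 1) - U (i + 1)) (V (i + 1 + 1) + U (i + 1 + 1)) :=
    Finset.sum_nonneg fun _ _ => edgeForm_nonneg _ _
  rw [edgeForm_comm] at h2
  simp only [zero_add, sub_zero, add_zero]
  linarith

/-- If all edge forms vanish, then V = U and V = -U at every inner layer, and U = 0 at the two ends.
-/
theorem strip_posForm {s : ℕ} (hs : 3 ≤ s) : (strip s).PosForm 0 := by
  intro y hy
  obtain ⟨V, U, hU0, hU1, hV, hU, h⟩ := strip_form hs y
  simp only [Pi.zero_apply, sub_zero, one_mul]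
  rw [← sub_pos, h]
  by_contra hc
  have hl := lambdaStar_pos
  have h1 : ∀ i ∈ Finset.range (s - 1), 0 ≤ edgeForm (V i - U i) (V (i + 1) + U (i + 1)) :=
    fun _ _ => edgeForm_nonneg _ _
  have h2 : 0 ≤ lambdaStar / 2 * (V 0 ^ 2 + V (s - 1) ^ 2) := by positivity
  have h3 := Finset.sum_nonneg h1
  have h4 : ∀ i, i < s - 1 → V i - U i = 0 ∧ V (i + 1) + U (i + 1) = 0 := fun i hi => by
    refine eq_zero_of_edgeForm (le_of_eq ((Finset.sum_eq_zero_iff_of_nonneg h1).1 ?_ i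
      (Finset.mem_range.2 hi)))
    linarith
  have h5 : ∀ i, i < s → V i = 0 ∧ U i = 0 := fun i hi => by
    rcases i with _ | i
    · have := (h4 0 (by omega)).1
      rw [hU0, sub_zero] at this
      exact ⟨this, hU0⟩
    · have h6 := (h4 i (by omega)).2
      by_cases h7 : i + 1 = s - 1
      · have h8 : U (i + 1) = 0 := h7 ▸ hU1
        exact ⟨by linarith, h8⟩
      · have h8 := (h4 (i + 1) (by omega)).1
        constructor <;> linarith
  apply hy
  ext (i | j)
  · rw [hV]; exact (h5 i i.2).1
  · rw [hU]; exact (h5 _ (by omega)).2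

/-! ### Joining two end pieces by the strip -/

theorem PosForm.lt_of_single {V : Type*} [Fintype V] [DecidableEq V] {G : SignedGraph V} {v : V}
    {r : ℝ} (h : G.PosForm (Pi.single v r)) {x : V → ℝ} (hx : x ≠ 0) :
    lambdaStar * r * x v ^ 2 < lambdaStar * ∑ i, x i ^ 2 - G.adjForm x := by
  have h1 := h x hx
  have h2 := sum_weight_add_single 0 x v r
  simp only [zero_add, Pi.zero_apply, sub_zero, one_mul] at h2
  rw [h2] at h1
  linarith

theorem PosForm.le_of_single {V : Type*} [Fintype V] [DecidableEq V] {G : SignedGraph V} {v : V}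
    {r : ℝ} (h : G.PosForm (Pi.single v r)) (x : V → ℝ) :
    lambdaStar * r * x v ^ 2 ≤ lambdaStar * ∑ i, x i ^ 2 - G.adjForm x := by
  by_cases hx : x = 0
  · simp [hx, adjForm]
  · exact (h.lt_of_single hx).le

/-- The weights 1/√5 at the roots pay exactly for the two boundary terms of the strip. Strictness
comes from an end piece on which the vector is nonzero, or else from the strip alone. -/
theorem PosForm.stripJoin {V W : Type*} [Fintype V] [Fintype W] [DecidableEq V] [DecidableEq W]
    {G : SignedGraph V} {v : V} {H : SignedGraph W} {u : W} {s : ℕ} (hs : 3 ≤ s)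
    (hG : G.PosForm (Pi.single v (1 / √5))) (hH : H.PosForm (Pi.single u (1 / √5))) :
    (G.stripJoin v s hs u H).PosForm 0 := by
  intro x hx
  rw [SignedGraph.stripJoin, bridge_adjForm, bridge_adjForm]
  simp only [Pi.zero_apply, sub_zero, one_mul,
    Fintype.sum_sum_type (α₁ := V ⊕ (Fin s ⊕ Fin (s - 2))), Fintype.sum_sum_type (α₁ := V)]
  let p : V → ℝ := fun i => x (.inl (.inl i))
  let y : Fin s ⊕ Fin (s - 2) → ℝ := fun i => x (.inl (.inr i))
  let q : W → ℝ := fun i => x (.inr i)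
  have hp := hG.le_of_single p
  have hy := strip_ends_nonneg hs (p v) (q u) y
  have hq := hH.le_of_single q
  suffices h : 0 < (lambdaStar * ∑ i, p i ^ 2 - G.adjForm p - lambdaStar * (1 / √5) * p v ^ 2) +
      (lambdaStar * ∑ i, q i ^ 2 - H.adjForm q - lambdaStar * (1 / √5) * q u ^ 2) +
      (lambdaStar * ∑ i, y i ^ 2 - (strip s).adjForm y - 2 * p v * y (.inl ⟨0, by omega⟩) -
        2 * q u * y (.inl ⟨s - 1, by omega⟩) +
          lambdaStar * (1 / √5) * (p v ^ 2 + q u ^ 2)) by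
    simp only [p, q, y, Function.comp_def] at h ⊢
    linarith
  by_cases hp0 : p = 0
  · by_cases hq0 : q = 0
    · have hy0 : y ≠ 0 := fun hy0 => hx (by
        ext ((i | i) | i)
        · exact congrFun hp0 i
        · exact congrFun hy0 i
        · exact congrFun hq0 i)
      have := strip_posForm hs y hy0
      simp only [Pi.zero_apply, sub_zero, one_mul] at this
      simp [hp0, hq0]
      simpa [adjForm] using this
    · have := hH.lt_of_single hq0
      linarith
  · have := hG.lt_of_single hp0
    linarith

/-! ### Even cycles -/

theorem cycle_adjForm {k : ℕ} (hk : 3 ≤ k) (ε : SignType) (x : Fin k → ℝ) :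
    (cycle k ε).adjForm x = (path k).adjForm x +
      2 * ((ε : ℝ) * x ⟨0, by omega⟩ * x ⟨k - 1, by omega⟩) := by
  have k0 : 0 < k := by omega
  have k1 : k - 1 < k := by omega
  have h : ∀ i j, (((cycle k ε).sgn i j : SignType) : ℝ) * x i * x j =
      (((path k).sgn i j : SignType) : ℝ) * x i * x j +
        (if j = ⟨k - 1, by omega⟩ then (if i = ⟨0, by omega⟩ then
          (ε : ℝ) * x ⟨0, by omega⟩ * x ⟨k - 1, by omega⟩ else 0) else 0) +
        (if j = ⟨0, by omega⟩ then (if i = ⟨k - 1, by omega⟩ then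
          (ε : ℝ) * x ⟨0, by omega⟩ * x ⟨k - 1, by omega⟩ else 0) else 0) := fun i j => by
    by_cases h1 : i.val + 1 = j.val ∨ j.val + 1 = i.val
    · rw [← ite_and, ← ite_and, if_neg, if_neg]
      · simp [cycle, path, h1]
      · simp only [Fin.ext_iff]; omega
      · simp only [Fin.ext_iff]; omega
    · by_cases h2 : i.val = 0 ∧ j.val = k - 1
      · obtain rfl : i = ⟨0, k0⟩ := Fin.ext h2.1
        obtain rfl : j = ⟨k - 1, k1⟩ := Fin.ext h2.2
        have h3 : ¬ 1 = k - 1 := by omega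
        have h4 : ¬ 0 = k - 1 := by omega
        have h5 : k - 1 + 1 = k := by omega
        simp [cycle, path, h3, h4, h5, show ¬ k = 0 by omega]
      · by_cases h3 : j.val = 0 ∧ i.val = k - 1
        · obtain rfl : j = ⟨0, k0⟩ := Fin.ext h3.1
          obtain rfl : i = ⟨k - 1, k1⟩ := Fin.ext h3.2
          have h3 : ¬ 1 = k - 1 := by omega
          have h4 : ¬ 0 = k - 1 := by omega
          have h5 : k - 1 + 1 = k := by omega
          have h6 : ¬ k - 1 = 0 := by omega
          simp [cycle, path, h3, h4, h5, h6, show ¬ k = 0 by omega]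
          ring
        · rw [← ite_and, ← ite_and, if_neg, if_neg]
          · have : ¬ (i ≠ j ∧ (i.val = 0 ∧ j.val + 1 = k ∨ j.val = 0 ∧ i.val + 1 = k)) := by omega
            simp only [cycle, path, if_neg h1, if_neg this]
            simp
          · simp only [Fin.ext_iff]; omega
          · simp only [Fin.ext_iff]; omega
  simp only [adjForm, h, Finset.sum_add_distrib, Finset.sum_ite_eq', Finset.mem_univ, if_true]
  ring

theorem cycle_form {k : ℕ} (hk : 3 ≤ k) {ε : SignType} (hε : ε ≠ 0) (x : Fin k → ℝ) :
    ∃ X : ℕ → ℝ, (∀ i : Fin k, x i = X i) ∧ X k = (ε : ℝ) * X 0 ∧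
      lambdaStar * ∑ i, x i ^ 2 - (cycle k ε).adjForm x =
        ∑ i ∈ Finset.range k, edgeForm (X i) (X (i + 1)) := by
  obtain ⟨n, rfl⟩ : ∃ n, k = n + 1 := ⟨k - 1, by omega⟩
  -- Setting X_k = εX_0 turns the closing edge into an ordinary edge; the squares still match
  -- because ε² = 1.
  let X : ℕ → ℝ := fun i => if h : i < n + 1 then x ⟨i, h⟩ else (ε : ℝ) * x 0
  have hX : ∀ i : Fin (n + 1), x i = X i := fun i => by
    simp only [X, i.is_lt, dif_pos]
  have hk : X (n + 1) = (ε : ℝ) * X 0 := by simp [X]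
  clear_value X
  refine ⟨X, hX, hk, ?_⟩
  obtain rfl : x = fun i : Fin (n + 1) => X i := funext hX
  have hε2 : (ε : ℝ) ^ 2 = 1 := by
    cases ε <;> simp at hε ⊢
  have h1 : ∑ i ∈ Finset.range (n + 1), X (i + 1) ^ 2 = ∑ i ∈ Finset.range (n + 1), X i ^ 2 := by
    have := Finset.sum_range_succ (fun i => X i ^ 2) (n + 1)
    rw [Finset.sum_range_succ', hk, mul_pow, hε2] at this
    linarith
  rw [cycle_adjForm (by omega), path_adjForm, Fin.sum_univ_eq_sum_range (fun i => X i ^ 2)]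
  simp only [edgeForm, Finset.sum_sub_distrib, ← Finset.mul_sum, Finset.sum_add_distrib, h1,
    mul_assoc]
  rw [Finset.sum_range_succ (fun i => X i * X (i + 1)), hk]
  simp only [Nat.add_sub_cancel]
  ring

/-- Parallelogram law for an edge and its mirror image under i ↦ 2m - i. -/
theorem sum_edgeForm_fold (m : ℕ) (X : ℕ → ℝ) :
    ∑ i ∈ Finset.range (2 * m), edgeForm (X i) (X (i + 1)) =
      (∑ i ∈ Finset.range m, edgeForm (X i + X (2 * m - i)) (X (i + 1) + X (2 * m - (i + 1))) +
        ∑ i ∈ Finset.range m,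
          edgeForm (X i - X (2 * m - i)) (X (i + 1) - X (2 * m - (i + 1)))) / 2 := by
  rw [two_mul m, Finset.sum_range_add,
    ← Finset.sum_range_reflect (fun i => edgeForm (X (m + i)) _) m, ← Finset.sum_add_distrib,
      ← Finset.sum_add_distrib,
    Finset.sum_div]
  refine Finset.sum_congr rfl fun i hi => ?_
  have := Finset.mem_range.1 hi
  rw [show m + (m - 1 - i) = m + m - (i + 1) by omega,
    show m + m - (i + 1) + 1 = m + m - i by omega]
  simp only [edgeForm]
  ring

/-- A square plus a telescoping difference: λ*ψ² is the ratio of the decaying solution of the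
recurrence along a path at λ*. -/
theorem edgeForm_eq (a b : ℝ) : edgeForm a b = lambdaStar * psi * (b -
  lambdaStar * psi ^ 2 * a) ^ 2 +
    lambdaStar * psi ^ 3 / 2 * (a ^ 2 - b ^ 2) := by
  rw [edgeForm]
  linear_combination (2 * a * b - lambdaStar * psi ^ 2 * a ^ 2) * lambdaStar_sq_mul +
    (lambdaStar / 2 * (psi - 1) * b ^ 2 - lambdaStar / 2 * (1 + psi) * a ^ 2) * psi_sq

/-- Telescoping gives the bound. In the equality case D_{i+1} is a fixed nonzero multiple of D_i, so
D_m = 0 propagates backwards. This case is needed because the weight ψ³ of a pendant edge uses up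
the whole bound. -/
theorem le_sum_edgeForm {m : ℕ} {D : ℕ → ℝ} (hD : D m = 0) :
    lambdaStar * psi ^ 3 / 2 * D 0 ^ 2 ≤ ∑ i ∈ Finset.range m, edgeForm (D i) (D (i + 1)) ∧
      (∑ i ∈ Finset.range m, edgeForm (D i) (D (i + 1)) ≤ lambdaStar * psi ^ 3 / 2 * D 0 ^ 2 →
        ∀ i ≤ m, D i = 0) := by
  have hl := mul_pos lambdaStar_pos psi_pos
  have h1 : ∑ i ∈ Finset.range m, edgeForm (D i) (D (i + 1)) =
      ∑ i ∈ Finset.range m, lambdaStar * psi * (D (i + 1) - lambdaStar * psi ^ 2 * D i) ^ 2 +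
        lambdaStar * psi ^ 3 / 2 * D 0 ^ 2 := by
    have := Finset.sum_range_sub' (fun i => D i ^ 2) m
    rw [hD] at this
    simp only [edgeForm_eq, Finset.sum_add_distrib, ← Finset.mul_sum, this]
    ring
  have h2 : ∀ i ∈ Finset.range m,
      0 ≤ lambdaStar * psi * (D (i + 1) - lambdaStar * psi ^ 2 * D i) ^ 2 :=
    fun i _ => by positivity
  rw [h1]
  refine ⟨le_add_of_nonneg_left (Finset.sum_nonneg h2), fun h => ?_⟩
  have h3 := (Finset.sum_eq_zero_iff_of_nonneg h2).1
    (le_antisymm (by linarith) (Finset.sum_nonneg h2))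
  have h4 : ∀ j ≤ m, D (m - j) = 0 := fun j => by
    induction j with
    | zero => exact fun _ => hD
    | succ j ih =>
      intro hj
      have h5 := h3 (m - (j + 1)) (Finset.mem_range.2 (by omega))
      rw [show m - (j + 1) + 1 = m - j by omega, ih (by omega)] at h5
      have h6 : (lambdaStar * psi ^ 2 * D (m - (j + 1))) ^ 2 = 0 := by
        have := (mul_eq_zero.1 h5).resolve_left hl.ne'
        rwa [zero_sub, neg_sq] at this
      have h7 : lambdaStar * psi ^ 2 ≠ 0 := by have := psi_pos; have := lambdaStar_pos; positivity
      exact (mul_eq_zero.1 (pow_eq_zero_iff (two_ne_zero) |>.1 h6)).resolve_left h7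
  intro i hi
  simpa [Nat.sub_sub_self hi] using h4 (m - i) (by omega)

theorem le_sum_edgeForm' {m : ℕ} {S : ℕ → ℝ} (hS : S 0 = 0) :
    lambdaStar * psi ^ 3 / 2 * S m ^ 2 ≤ ∑ i ∈ Finset.range m, edgeForm (S i) (S (i + 1)) ∧
      (∑ i ∈ Finset.range m, edgeForm (S i) (S (i + 1)) ≤ lambdaStar * psi ^ 3 / 2 * S m ^ 2 →
        ∀ i ≤ m, S i = 0) := by
  have h := le_sum_edgeForm (m := m) (D := fun i => S (m - i)) (by simpa using hS)
  have h1 : ∑ i ∈ Finset.range m, edgeForm (S (m - i)) (S (m - (i + 1))) =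
      ∑ i ∈ Finset.range m, edgeForm (S i) (S (i + 1)) := by
    rw [← Finset.sum_range_reflect]
    refine Finset.sum_congr rfl fun i hi => ?_
    have := Finset.mem_range.1 hi
    rw [edgeForm_comm, show m - (m - 1 - i + 1) = i by omega, show m - (m - 1 - i) = i + 1 by omega]
  rw [h1, Nat.sub_zero] at h
  exact ⟨h.1, fun h2 i hi => by simpa [Nat.sub_sub_self hi] using h.2 h2 (m - i) (by omega)⟩

theorem cycle_posForm {k : ℕ} (hk : 4 ≤ k) (he : Even k) :
    (cycle k (-1)).PosForm (0 + Pi.single ⟨k / 2, by omega⟩ (psi ^ 3) +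
      Pi.single ⟨0, by omega⟩ (psi ^ 3)) := by
  obtain ⟨m, rfl⟩ : ∃ m, k = 2 * m := he.exists_two_nsmul _ |>.imp fun _ h => by simpa using h
  intro x hx
  obtain ⟨X, hX, hX0, h⟩ := cycle_form (ε := -1) (by omega) (by decide) x
  rw [sum_weight_add_single, sum_weight_add_single, hX, hX]
  simp only [Pi.zero_apply, sub_zero, one_mul, SignType.coe_neg, SignType.coe_one,
    show 2 * m / 2 = m by omega] at hX0 ⊢
  by_contra hc
  rw [sum_edgeForm_fold] at h
  -- The antisymmetric part vanishes at m by reflection; the symmetric part vanishes at 0 because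
  -- the cycle is unbalanced. Their other ends are 2X_0 and 2X_m.
  obtain ⟨d1, d2⟩ := le_sum_edgeForm (m := m) (D := fun i => X i - X (2 * m - i))
    (by simp [two_mul])
  obtain ⟨s1, s2⟩ := le_sum_edgeForm' (m := m) (S := fun i => X i + X (2 * m - i))
    (by simp [hX0])
  simp only [Nat.sub_zero, hX0, show 2 * m - m = m by omega] at d1 d2 s1 s2
  have d3 := d2 (by linarith)
  have s3 := s2 (by linarith)
  apply hx
  ext i
  rw [hX]
  rcases le_total i.val m with hi | hi
  · have := d3 i hi; have := s3 i hi
    simp only [Pi.zero_apply]; linarith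
  · have h1 := d3 (2 * m - i) (by omega); have h2 := s3 (2 * m - i) (by omega)
    rw [show 2 * m - (2 * m - i.val) = i by omega] at h1 h2
    simp only [Pi.zero_apply]; linarith

theorem theta_adjForm {k : ℕ} (hk : 3 ≤ k) (x : Option (Fin k) → ℝ) :
    (theta k).adjForm x = (cycle k 1).adjForm (fun i => x (some i)) +
      2 * (x none * (x (some ⟨1, by omega⟩) - x (some ⟨k - 1, by omega⟩))) := by
  have k0 : 1 < k := by omega
  have k1 : k - 1 < k := by omega
  have h1 : ∀ i : Fin k, (((theta k).sgn (some i) none : SignType) : ℝ) * x (some i) * x none =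
      (if i = ⟨1, by omega⟩ then x none * x (some ⟨1, by omega⟩) else 0) -
        (if i = ⟨k - 1, by omega⟩ then x none * x (some ⟨k - 1, by omega⟩) else 0) := fun i => by
    have e : ((theta k).sgn (some i) none : SignType) =
      if i.val = 1 then 1 else if i.val + 1 = k then -1 else 0 := rfl
    rw [e]
    by_cases h1 : i.val = 1
    · obtain rfl : i = ⟨1, k0⟩ := Fin.ext h1
      have : ¬ 1 = k - 1 := by omega
      simp [this, mul_comm]
    · by_cases h2 : i.val + 1 = k
      · obtain rfl : i = ⟨k - 1, k1⟩ := Fin.ext (by simp; omega)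
        have h3 : ¬ k - 1 = 1 := by omega
        have h4 : k - 1 + 1 = k := by omega
        simp [h3, h4, mul_comm]
      · have : ¬ i.val = k - 1 := by omega
        simp [h1, h2, Fin.ext_iff, this]
  have h2 : ∀ i : Fin k, (((theta k).sgn none (some i) : SignType) : ℝ) * x none * x (some i) =
      (((theta k).sgn (some i) none : SignType) : ℝ) * x (some i) * x none := fun i => by
    rw [(theta k).symm]; ring
  have h3 : ∀ i j : Fin k, (theta k).sgn (some i) (some j) = (cycle k 1).sgn i j := fun _ _ => rfl
  simp only [adjForm, Fintype.sum_option, h2, h1, h3, (theta k).irrefl, Finset.sum_add_distrib,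
    Finset.sum_sub_distrib, Finset.sum_ite_eq', Finset.mem_univ, if_true, SignType.coe_zero]
  ring

/-- The outer vertex is adjacent to the same two vertices as the cycle vertex 0, but with opposite
signs. After folding, vertex 0 enters only the symmetric part and the outer vertex only the
antisymmetric part. -/
theorem theta_posForm {k : ℕ} (hk : 4 ≤ k) (he : Even k) :
    (theta k).PosForm (0 + Pi.single none (psi ^ 3)) := by
  obtain ⟨m, rfl⟩ : ∃ m, k = 2 * m := he.exists_two_nsmul _ |>.imp fun _ h => by simpa using h
  obtain ⟨n, rfl⟩ : ∃ n, m = n + 1 := ⟨m - 1, by omega⟩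
  intro x hx
  obtain ⟨X, hX, hX0, h⟩ := cycle_form (ε := 1) (by omega) (by decide) (fun i => x (some i))
  rw [sum_weight_add_single, theta_adjForm (by omega), Fintype.sum_option, hX, hX]
  simp only [SignType.coe_one, one_mul, Pi.zero_apply, sub_zero] at hX0 ⊢
  by_contra hc
  set u := x none
  rw [sum_edgeForm_fold] at h
  -- The antisymmetric part of the cycle is 0 at index 0, so this place is free for 2u.
  let D : ℕ → ℝ := fun i => if i = 0 then 2 * u else X i - X (2 * (n + 1) - i)
  have hD : ∑ i ∈ Finset.range (n + 1), edgeForm (D i) (D (i + 1)) =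
      ∑ i ∈ Finset.range (n + 1), edgeForm (X i - X (2 * (n + 1) - i))
        (X (i + 1) - X (2 * (n + 1) - (i + 1))) + 2 * lambdaStar * u ^ 2 -
          4 * u * (X 1 - X (2 * (n + 1) - 1)) := by
    simp only [Finset.sum_range_succ' _ n, D, edgeForm]
    simp [hX0]
    ring
  obtain ⟨d1, d2⟩ := le_sum_edgeForm (m := n + 1) (D := D)
    (by simp [D, show 2 * (n + 1) - (n + 1) = n + 1 by omega])
  have s1 : ∀ i ∈ Finset.range (n + 1), 0 ≤ edgeForm (X i + X (2 * (n + 1) - i))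
      (X (i + 1) + X (2 * (n + 1) - (i + 1))) := fun _ _ => edgeForm_nonneg _ _
  have s2 := Finset.sum_nonneg s1
  have hD0 : D 0 = 2 * u := rfl
  rw [hD0, hD] at d1 d2
  have d3 := d2 (by linarith)
  have s3 := (Finset.sum_eq_zero_iff_of_nonneg s1).1 (le_antisymm (by linarith) s2)
  have hu : u = 0 := by
    have := d3 0 (by omega); rw [hD0] at this; linarith
  have hd : ∀ i ≤ n + 1, X i - X (2 * (n + 1) - i) = 0 := fun i hi => by
    rcases i with _ | i
    · simp [hX0]
    · exact d3 (i + 1) hi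
  have hs : ∀ i ≤ n + 1, X i + X (2 * (n + 1) - i) = 0 := fun i hi => by
    rcases i with _ | i
    · exact (eq_zero_of_edgeForm (s3 0 (by simp)).le).1
    · exact (eq_zero_of_edgeForm (s3 i (by simp; omega)).le).2
  apply hx
  ext (_ | i)
  · exact hu
  rw [hX]
  rcases le_total i.val (n + 1) with hi | hi
  · have := hd i hi; have := hs i hi
    simp only [Pi.zero_apply]; linarith
  · have h1 := hd (2 * (n + 1) - i) (by omega); have h2 := hs (2 * (n + 1) - i) (by omega)
    rw [show 2 * (n + 1) - (2 * (n + 1) - i.val) = i by omega] at h1 h2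
    simp only [Pi.zero_apply]; linarith

/-! ### Certificates for the small graphs -/

/-- Rescaling one colour class by λ* makes the whole form λ* times a form over ℚ(ψ). In each
certificate below the terms `n0`, `n1`, … are the squares of an LDLᵀ decomposition with positive
pivots; if the form were not positive they would all vanish, and back substitution would give x = 0.
-/
theorem exists_eq_lambdaStar_mul (x : ℝ) : ∃ y, x = lambdaStar * y :=
  ⟨x / lambdaStar, by have := lambdaStar_pos; field_simp⟩

theorem nonpos_of_lambdaStar_mul {x : ℝ} (h : lambdaStar * x ≤ 0) : x ≤ 0 := by
  by_contra hx
  exact absurd (mul_pos lambdaStar_pos (not_le.1 hx)) (not_lt.2 h)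

theorem term_nonneg {d l : ℝ} (hd : 0 < d) : 0 < d ∧ 0 ≤ d * l ^ 2 :=
  ⟨hd, by positivity⟩

theorem eq_zero_of_term {d l : ℝ} (h : 0 < d ∧ 0 ≤ d * l ^ 2) (h' : d * l ^ 2 ≤ 0) : l = 0 := by
  have h1 := (mul_eq_zero.1 (le_antisymm h' h.2)).resolve_left h.1.ne'
  exact pow_eq_zero_iff (two_ne_zero) |>.1 h1

theorem sum_fin_nine (f : Fin 9 → ℝ) :
    ∑ i, f i = f 0 + f 1 + f 2 + f 3 + f 4 + f 5 + f 6 + f 7 + f 8 := by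
  rw [Fin.sum_univ_castSucc, Fin.sum_univ_eight]; rfl

theorem adjForm_path_four (x : Fin 4 → ℝ) : (path 4).adjForm x =
    2 * (x 0 * x 1 + x 1 * x 2 + x 2 * x 3) := by
  simp [adjForm, path, Fin.sum_univ_succ]
  ring

theorem path_four_posForm {r : ℝ} (hr : r = (2 * psi + 1) / 5) :
    (path 4).PosForm (0 + Pi.single 1 r : Fin 4 → ℝ) := by
  intro x hx
  obtain ⟨y1, hy1⟩ := exists_eq_lambdaStar_mul (x 1)
  obtain ⟨y3, hy3⟩ := exists_eq_lambdaStar_mul (x 3)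
  by_contra hc
  simp only [sum_weight_add_single, adjForm_path_four, Fin.sum_univ_four, Pi.zero_apply,
    sub_zero, one_mul, not_lt] at hc
  obtain ⟨p1, p2⟩ := psi_bounds
  have n0 := term_nonneg (d := 1)
    (l := x 0 - y1) (by linarith)
  have n1 := term_nonneg (d := (2 * psi + 3))
    (l := y3 - (2 * psi - 1) * x 2) (by linarith)
  have n2 := term_nonneg (d := (-2 * psi + 2))
    (l := x 2 - (psi + 2) / 2 * y1) (by linarith)
  have n3 := term_nonneg (d := (7 * psi - 4) / 10)
    (l := y1) (by linarith)
  have hle :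
      1 * (x 0 - y1) ^ 2 + (2 * psi + 3) * (y3 - (2 * psi - 1) * x 2) ^ 2 +
      (-2 * psi + 2) * (x 2 - (psi + 2) / 2 * y1) ^ 2 + ((7 * psi - 4) / 10) * y1 ^ 2 ≤ 0 := by
    refine nonpos_of_lambdaStar_mul ?_
    rw [hy1, hy3, hr] at hc
    linear_combination hc - lambdaStar * (
        (-2 * psi + 4) / 5 * y1 ^ 2 + y3 ^ 2) * lambdaStar_sq' - lambdaStar * (
        (5 * psi + 2) / 10 * y1 ^ 2 + (-8 * psi + 4) * x 2 ^ 2 + (-2) * y1 * x 2 +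
          8 * x 2 * y3) * psi_sq
  have z0 := eq_zero_of_term n0 (by linarith)
  have z1 := eq_zero_of_term n1 (by linarith)
  have z2 := eq_zero_of_term n2 (by linarith)
  have z3 := eq_zero_of_term n3 (by linarith)
  simp only [z3, mul_zero, sub_zero] at z2
  simp only [z2, mul_zero, sub_zero] at z1
  simp only [z3, sub_zero] at z0
  rw [z3, mul_zero] at hy1
  rw [z1, mul_zero] at hy3
  apply hx
  ext i
  fin_cases i
  exacts [z0, hy1, z2, hy3]

theorem adjForm_cycle_four (x : Fin 4 → ℝ) : (cycle 4 (-1)).adjForm x =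
    2 * (x 0 * x 1 + x 1 * x 2 + x 2 * x 3 - x 0 * x 3) := by
  simp [adjForm, cycle, Fin.sum_univ_succ]
  ring

/-- The core of G_5^{10}: q and r are the weights `ratio_neg_four` and `ratio_psi_two` of its two
paths. -/
theorem cycle_four_posForm_adjacent {q r : ℝ} (hq : q = (8 * psi - 1) / 10) (hr : r = psi / 2) :
    (cycle 4 (-1)).PosForm (0 + Pi.single 1 q + Pi.single 0 r : Fin 4 → ℝ) := by
  intro x hx
  obtain ⟨y1, hy1⟩ := exists_eq_lambdaStar_mul (x 1)
  obtain ⟨y3, hy3⟩ := exists_eq_lambdaStar_mul (x 3)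
  by_contra hc
  simp only [sum_weight_add_single, adjForm_cycle_four, Fin.sum_univ_four, Pi.zero_apply,
    sub_zero, one_mul, not_lt] at hc
  obtain ⟨p1, p2⟩ := psi_bounds
  have n0 := term_nonneg (d := (2 * psi + 3))
    (l := y3 - (2 * psi - 1) * x 2 + (2 * psi - 1) * x 0) (by linarith)
  have n1 := term_nonneg (d := (-2 * psi + 2))
    (l := x 2 - (psi + 2) / 2 * y1 + psi / 2 * x 0) (by linarith)
  have n2 := term_nonneg (d := (9 * psi + 7) / 10)
    (l := y1 - (25 * psi - 5) / 19 * x 0) (by linarith)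
  have n3 := term_nonneg (d := (-118 * psi + 73) / 38)
    (l := x 0) (by linarith)
  have hle :
      (2 * psi + 3) * (y3 - (2 * psi - 1) * x 2 + (2 * psi - 1) * x 0) ^ 2 +
      (-2 * psi + 2) * (x 2 - (psi + 2) / 2 * y1 + psi / 2 * x 0) ^ 2 +
      ((9 * psi + 7) / 10) * (y1 - (25 * psi - 5) / 19 * x 0) ^ 2 +
      ((-118 * psi + 73) / 38) * (x 0) ^ 2 ≤ 0 := by
    refine nonpos_of_lambdaStar_mul ?_
    rw [hy1, hy3, hq, hr] at hc
    linear_combination hc - lambdaStar * (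
        (-8 * psi + 11) / 10 * y1 ^ 2 + y3 ^ 2) * lambdaStar_sq' - lambdaStar * (
        (-3270 * psi + 1433) / 361 * x 0 ^ 2 + (5 * psi - 6) / 10 * y1 ^ 2 +
        (-8 * psi + 4) * x 2 ^ 2 + (-19 * psi + 45) / 19 * x 0 * y1 + (-2) * y1 * x 2 +
        8 * x 2 * y3 + (-8) * x 0 * y3 + (16 * psi - 6) * x 0 * x 2) * psi_sq
  have z0 := eq_zero_of_term n0 (by linarith)
  have z1 := eq_zero_of_term n1 (by linarith)
  have z2 := eq_zero_of_term n2 (by linarith)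
  have z3 := eq_zero_of_term n3 (by linarith)
  simp only [z3, mul_zero, sub_zero] at z2
  simp only [z2, z3, mul_zero, add_zero, sub_zero] at z1
  simp only [z1, z3, mul_zero, add_zero, sub_zero] at z0
  rw [z2, mul_zero] at hy1
  rw [z0, mul_zero] at hy3
  apply hx
  ext i
  fin_cases i
  exacts [z3, hy1, z1, hy3]

/-- Eliminating the two vertices with pendant edges leaves no coupling between the other two, since
the two routes have opposite signs and equal weights. What is left is diagonal with pivots ψ² - t
and ψ² - r. -/
theorem cycle_four_posForm_pendants {q t r : ℝ}
    (hq : q = (2 * psi - 1))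
    (ht : t < psi ^ 2)
    (hr : r < psi ^ 2) :
    (cycle 4 (-1)).PosForm (0 + Pi.single 3 q + Pi.single 2 t + Pi.single 1 q + Pi.single 0 r :
      Fin 4 → ℝ) := by
  intro x hx
  obtain ⟨y1, hy1⟩ := exists_eq_lambdaStar_mul (x 1)
  obtain ⟨y3, hy3⟩ := exists_eq_lambdaStar_mul (x 3)
  by_contra hc
  simp only [sum_weight_add_single, adjForm_cycle_four, Fin.sum_univ_four, Pi.zero_apply,
    sub_zero, one_mul, not_lt] at hc
  obtain ⟨p1, p2⟩ := psi_bounds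
  have n0 := term_nonneg (d := (2 * psi + 2))
    (l := y1 - psi / 2 * x 0 - psi / 2 * x 2) (by linarith)
  have n1 := term_nonneg (d := (2 * psi + 2))
    (l := y3 + psi / 2 * x 0 - psi / 2 * x 2) (by linarith)
  have n2 := term_nonneg (d := (psi ^ 2 - t))
    (l := x 2) (by linarith)
  have n3 := term_nonneg (d := (psi ^ 2 - r))
    (l := x 0) (by linarith)
  have hle :
      (2 * psi + 2) * (y1 - psi / 2 * x 0 - psi / 2 * x 2) ^ 2 +
      (2 * psi + 2) * (y3 + psi / 2 * x 0 - psi / 2 * x 2) ^ 2 + (psi ^ 2 - t) * (x 2) ^ 2 +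
      (psi ^ 2 - r) * (x 0) ^ 2 ≤ 0 := by
    refine nonpos_of_lambdaStar_mul ?_
    rw [hy1, hy3, hq] at hc
    linear_combination hc - lambdaStar * (
        (-2 * psi + 2) * y1 ^ 2 + (-2 * psi + 2) * y3 ^ 2) * lambdaStar_sq' - lambdaStar * (
        (-psi - 1) * x 0 ^ 2 + (-4) * y1 ^ 2 + (-psi - 1) * x 2 ^ 2 + (-4) * y3 ^ 2 +
        2 * x 0 * y1 + 2 * y1 * x 2 + 2 * x 2 * y3 + (-2) * x 0 * y3) * psi_sq
  have z0 := eq_zero_of_term n0 (by linarith)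
  have z1 := eq_zero_of_term n1 (by linarith)
  have z2 := eq_zero_of_term n2 (by linarith)
  have z3 := eq_zero_of_term n3 (by linarith)
  simp only [z3, z2, mul_zero, add_zero, sub_zero] at z1
  simp only [z3, z2, mul_zero, sub_zero] at z0
  rw [z0, mul_zero] at hy1
  rw [z1, mul_zero] at hy3
  apply hx
  ext i
  fin_cases i
  exacts [z3, hy1, z2, hy3]

theorem adjForm_cycle_six (x : Fin 6 → ℝ) : (cycle 6 (-1)).adjForm x =
    2 * (x 0 * x 1 + x 1 * x 2 + x 2 * x 3 + x 3 * x 4 + x 4 * x 5 - x 0 * x 5) := by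
  simp [adjForm, cycle, Fin.sum_univ_succ]
  ring

/-- The two routes between the opposite vertices again cancel, leaving the defects of t and r from
the limit weight ψ². -/
theorem cycle_six_posForm {t r : ℝ} (ht : t < psi ^ 2) (hr : r < psi ^ 2) :
    (cycle 6 (-1)).PosForm (0 + Pi.single 3 t + Pi.single 0 r : Fin 6 → ℝ) := by
  intro x hx
  obtain ⟨y1, hy1⟩ := exists_eq_lambdaStar_mul (x 1)
  obtain ⟨y3, hy3⟩ := exists_eq_lambdaStar_mul (x 3)
  obtain ⟨y5, hy5⟩ := exists_eq_lambdaStar_mul (x 5)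
  by_contra hc
  simp only [sum_weight_add_single, adjForm_cycle_six, Fin.sum_univ_six, Pi.zero_apply,
    sub_zero, one_mul, not_lt] at hc
  obtain ⟨p1, p2⟩ := psi_bounds
  have n0 := term_nonneg (d := (2 * psi + 3))
    (l := y1 - (2 * psi - 1) * x 2 - (2 * psi - 1) * x 0) (by linarith)
  have n1 := term_nonneg (d := (-2 * psi + 2))
    (l := x 2 - psi / 2 * x 0 - (psi + 2) / 2 * y3) (by linarith)
  have n2 := term_nonneg (d := 1)
    (l := x 4 - y5 - y3) (by linarith)
  have n3 := term_nonneg (d := (2 * psi + 2))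
    (l := y5 + psi / 2 * x 0 - psi / 2 * y3) (by linarith)
  -- The factor 3 + 2ψ = λ*² stems from the rescaling of vertex 3.
  have n4 := term_nonneg (d := (psi ^ 2 - t) * (3 + 2 * psi))
    (l := y3) (by nlinarith)
  have n5 := term_nonneg (d := (psi ^ 2 - r))
    (l := x 0) (by linarith)
  have hle :
      (2 * psi + 3) * (y1 - (2 * psi - 1) * x 2 - (2 * psi - 1) * x 0) ^ 2 +
      (-2 * psi + 2) * (x 2 - psi / 2 * x 0 - (psi + 2) / 2 * y3) ^ 2 + 1 * (x 4 - y5 - y3) ^ 2 +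
      (2 * psi + 2) * (y5 + psi / 2 * x 0 - psi / 2 * y3) ^ 2 +
      ((psi ^ 2 - t) * (3 + 2 * psi)) * y3 ^ 2 + (psi ^ 2 - r) * (x 0) ^ 2 ≤ 0 := by
    refine nonpos_of_lambdaStar_mul ?_
    rw [hy1, hy3, hy5] at hc
    linear_combination hc - lambdaStar * (
        y1 ^ 2 + (1 - t) * y3 ^ 2 + y5 ^ 2) * lambdaStar_sq' - lambdaStar * (
        (-8 * psi + 2) * x 0 ^ 2 + (-8 * psi + 4) * x 2 ^ 2 + (-2 * psi) * y3 ^ 2 + 8 * x 0 * y1 +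
        8 * y1 * x 2 + (-2) * x 2 * y3 + (-2) * x 0 * y5 + (-16 * psi + 6) * x 0 * x 2 +
        2 * psi * x 0 * y3 + 2 * y3 * y5) * psi_sq
  have z0 := eq_zero_of_term n0 (by linarith)
  have z1 := eq_zero_of_term n1 (by linarith)
  have z2 := eq_zero_of_term n2 (by linarith)
  have z3 := eq_zero_of_term n3 (by linarith)
  have z4 := eq_zero_of_term n4 (by linarith)
  have z5 := eq_zero_of_term n5 (by linarith)
  simp only [z5, z4, mul_zero, add_zero, sub_zero] at z3
  simp only [z3, z4, sub_zero] at z2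
  simp only [z5, z4, mul_zero, sub_zero] at z1
  simp only [z1, z5, mul_zero, sub_zero] at z0
  rw [z0, mul_zero] at hy1
  rw [z4, mul_zero] at hy3
  rw [z3, mul_zero] at hy5
  apply hx
  ext i
  fin_cases i
  exacts [z5, hy1, z1, hy3, z2, hy5]

theorem adjForm_cycle_six_one (x : Fin 6 → ℝ) : (cycle 6 1).adjForm x =
    2 * (x 0 * x 1 + x 1 * x 2 + x 2 * x 3 + x 3 * x 4 + x 4 * x 5 + x 0 * x 5) := by
  simp [adjForm, cycle, Fin.sum_univ_succ]
  ring

theorem adjForm_domino (x : Fin 6 → ℝ) : domino.adjForm x =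
    2 * (x 0 * x 1 + x 1 * x 2 + x 3 * x 4 + x 4 * x 5 + x 0 * x 3 + x 2 * x 5 - x 1 * x 4) := by
  simp [adjForm, domino, ofEdges, Fin.sum_univ_succ]
  ring

/-- The core of G_2^9, with the weights of its path (`ratio_neg_two`) and of its pendant edge (ψ³ =
2ψ - 1). -/
theorem domino_posForm {r q : ℝ} (hr : r = 2 * psi / 3) (hq : q = (2 * psi - 1)) :
    domino.PosForm (0 + Pi.single 0 r + Pi.single 4 q : Fin 6 → ℝ) := by
  intro x hx
  obtain ⟨y1, hy1⟩ := exists_eq_lambdaStar_mul (x 1)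
  obtain ⟨y3, hy3⟩ := exists_eq_lambdaStar_mul (x 3)
  obtain ⟨y5, hy5⟩ := exists_eq_lambdaStar_mul (x 5)
  by_contra hc
  simp only [sum_weight_add_single, adjForm_domino, Fin.sum_univ_six, Pi.zero_apply,
    sub_zero, one_mul, not_lt] at hc
  obtain ⟨p1, p2⟩ := psi_bounds
  have n0 := term_nonneg (d := 1)
    (l := x 2 - y5 - y1) (by linarith)
  have n1 := term_nonneg (d := (2 * psi + 2))
    (l := y5 - psi / 2 * y1 - psi / 2 * x 4) (by linarith)
  have n2 := term_nonneg (d := (3 * psi + 4) / 2)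
    (l := y1 + (2 * psi - 1) * x 4 - (6 * psi - 2) / 5 * x 0) (by linarith)
  have n3 := term_nonneg (d := (2 * psi + 3))
    (l := y3 - (2 * psi - 1) * x 4 - (2 * psi - 1) * x 0) (by linarith)
  have n4 := term_nonneg (d := (-8 * psi + 5))
    (l := x 4) (by linarith)
  have n5 := term_nonneg (d := (-58 * psi + 36) / 15)
    (l := x 0) (by linarith)
  have hle :
      1 * (x 2 - y5 - y1) ^ 2 + (2 * psi + 2) * (y5 - psi / 2 * y1 - psi / 2 * x 4) ^ 2 +
      ((3 * psi + 4) / 2) * (y1 + (2 * psi - 1) * x 4 - (6 * psi - 2) / 5 * x 0) ^ 2 +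
      (2 * psi + 3) * (y3 - (2 * psi - 1) * x 4 - (2 * psi - 1) * x 0) ^ 2 +
      (-8 * psi + 5) * (x 4) ^ 2 + ((-58 * psi + 36) / 15) * (x 0) ^ 2 ≤ 0 := by
    refine nonpos_of_lambdaStar_mul ?_
    rw [hy1, hy3, hy5, hr, hq] at hc
    linear_combination hc - lambdaStar * (
        y1 ^ 2 + y3 ^ 2 + y5 ^ 2) * lambdaStar_sq' - lambdaStar * (
        (-254 * psi + 118) / 25 * x 0 ^ 2 + (-psi) / 2 * y1 ^ 2 + (-29 * psi + 16) / 2 * x 4 ^ 2 +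
        18 / 5 * x 0 * y1 + 8 * y3 * x 4 + 2 * x 4 * y5 + 8 * x 0 * y3 + (-psi - 6) * y1 * x 4 +
        2 * y1 * y5 + (-44 * psi + 22) / 5 * x 0 * x 4) * psi_sq
  have z0 := eq_zero_of_term n0 (by linarith)
  have z1 := eq_zero_of_term n1 (by linarith)
  have z2 := eq_zero_of_term n2 (by linarith)
  have z3 := eq_zero_of_term n3 (by linarith)
  have z4 := eq_zero_of_term n4 (by linarith)
  have z5 := eq_zero_of_term n5 (by linarith)
  simp only [z4, z5, mul_zero, sub_zero] at z3
  simp only [z4, z5, mul_zero, add_zero, sub_zero] at z2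
  simp only [z2, z4, mul_zero, sub_zero] at z1
  simp only [z1, z2, sub_zero] at z0
  rw [z2, mul_zero] at hy1
  rw [z3, mul_zero] at hy3
  rw [z1, mul_zero] at hy5
  apply hx
  ext i
  fin_cases i
  exacts [z5, hy1, z0, hy3, z4, hy5]

theorem adjForm_tromino (x : Fin 8 → ℝ) : tromino.adjForm x =
    2 * (x 0 * x 1 + x 1 * x 2 + x 3 * x 4 + x 4 * x 5 + x 0 * x 3 + x 2 * x 5 + x 4 * x 6
      + x 5 * x 7 - x 1 * x 4 - x 6 * x 7) := by
  simp [adjForm, tromino, ofEdges, Fin.sum_univ_succ]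
  ring

/-- The core of G_4^{12}, with the weight `ratio_neg_four` of its path. -/
theorem tromino_posForm {r : ℝ} (hr : r = (8 * psi - 1) / 10) :
    tromino.PosForm (0 + Pi.single 0 r : Fin 8 → ℝ) := by
  intro x hx
  obtain ⟨y1, hy1⟩ := exists_eq_lambdaStar_mul (x 1)
  obtain ⟨y3, hy3⟩ := exists_eq_lambdaStar_mul (x 3)
  obtain ⟨y5, hy5⟩ := exists_eq_lambdaStar_mul (x 5)
  obtain ⟨y6, hy6⟩ := exists_eq_lambdaStar_mul (x 6)
  by_contra hc
  simp only [sum_weight_add_single, adjForm_tromino, Fin.sum_univ_eight, Pi.zero_apply,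
    sub_zero, one_mul, not_lt] at hc
  obtain ⟨p1, p2⟩ := psi_bounds
  have n0 := term_nonneg (d := 1)
    (l := x 2 - y5 - y1) (by linarith)
  have n1 := term_nonneg (d := 1)
    (l := x 7 + y6 - y5) (by linarith)
  have n2 := term_nonneg (d := (2 * psi + 2))
    (l := y6 + psi / 2 * y5 - psi / 2 * x 4) (by linarith)
  have n3 := term_nonneg (d := (3 * psi + 2) / 2)
    (l := y5 - (6 * psi + 2) / 11 * y1 - (8 * psi - 1) / 11 * x 4) (by linarith)
  have n4 := term_nonneg (d := (16 * psi + 20) / 11)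
    (l := y1 + (2 * psi - 1) * x 4 - (4 * psi - 1) / 4 * x 0) (by linarith)
  have n5 := term_nonneg (d := (2 * psi + 3))
    (l := y3 - (2 * psi - 1) * x 4 - (2 * psi - 1) * x 0) (by linarith)
  have n6 := term_nonneg (d := (-8 * psi + 5))
    (l := x 4) (by linarith)
  have n7 := term_nonneg (d := (-76 * psi + 47) / 20)
    (l := x 0) (by linarith)
  have hle :
      1 * (x 2 - y5 - y1) ^ 2 + 1 * (x 7 + y6 - y5) ^ 2 +
      (2 * psi + 2) * (y6 + psi / 2 * y5 - psi / 2 * x 4) ^ 2 +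
      ((3 * psi + 2) / 2) * (y5 - (6 * psi + 2) / 11 * y1 - (8 * psi - 1) / 11 * x 4) ^ 2 +
      ((16 * psi + 20) / 11) * (y1 + (2 * psi - 1) * x 4 - (4 * psi - 1) / 4 * x 0) ^ 2 +
      (2 * psi + 3) * (y3 - (2 * psi - 1) * x 4 - (2 * psi - 1) * x 0) ^ 2 +
      (-8 * psi + 5) * (x 4) ^ 2 + ((-76 * psi + 47) / 20) * (x 0) ^ 2 ≤ 0 := by
    refine nonpos_of_lambdaStar_mul ?_
    rw [hy1, hy3, hy5, hy6, hr] at hc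
    linear_combination hc - lambdaStar * (
        y1 ^ 2 + y3 ^ 2 + y5 ^ 2 + y6 ^ 2) * lambdaStar_sq' - lambdaStar * (
        (-104 * psi + 48) / 11 * x 0 ^ 2 + (-54 * psi - 18) / 121 * y1 ^ 2 +
        (-3657 * psi + 2136) / 242 * x 4 ^ 2 + (-psi) / 2 * y5 ^ 2 + 32 / 11 * x 0 * y1 +
        8 * y3 * x 4 + (11 * psi + 24) / 11 * x 4 * y5 + 8 * x 0 * y3 + 2 * x 4 * y6 +
        (-144 * psi - 686) / 121 * y1 * x 4 + 18 / 11 * y1 * y5 + (-2) * y5 * y6 +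
        (-112 * psi + 56) / 11 * x 0 * x 4) * psi_sq
  have z0 := eq_zero_of_term n0 (by linarith)
  have z1 := eq_zero_of_term n1 (by linarith)
  have z2 := eq_zero_of_term n2 (by linarith)
  have z3 := eq_zero_of_term n3 (by linarith)
  have z4 := eq_zero_of_term n4 (by linarith)
  have z5 := eq_zero_of_term n5 (by linarith)
  have z6 := eq_zero_of_term n6 (by linarith)
  have z7 := eq_zero_of_term n7 (by linarith)
  simp only [z6, z7, mul_zero, sub_zero] at z5
  simp only [z6, z7, mul_zero, add_zero, sub_zero] at z4
  simp only [z4, z6, mul_zero, sub_zero] at z3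
  simp only [z3, z6, mul_zero, add_zero, sub_zero] at z2
  simp only [z2, z3, add_zero, sub_zero] at z1
  simp only [z3, z4, sub_zero] at z0
  rw [z4, mul_zero] at hy1
  rw [z5, mul_zero] at hy3
  rw [z3, mul_zero] at hy5
  rw [z2, mul_zero] at hy6
  apply hx
  ext i
  fin_cases i
  exacts [z7, hy1, z0, hy3, z6, hy5, hy6, z1]

theorem adjForm_graphS2core (x : Fin 9 → ℝ) : graphS2core.adjForm x =
    2 * (x 0 * x 1 + x 1 * x 2 + x 2 * x 3 + x 3 * x 4 + x 4 * x 5 + x 0 * x 6 + x 4 * x 6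
      + x 0 * x 7 + x 6 * x 8 - x 0 * x 5 - x 2 * x 6 - x 7 * x 8) := by
  simp [adjForm, graphS2core, ofEdges, Fin.sum_univ_succ]
  ring

-- Eliminating every vertex but 3 leaves a multiple of ψ² - r, so the attached path may be
-- arbitrarily long.
set_option maxHeartbeats 1600000 in
theorem graphS2core_posForm {r : ℝ} (hr : r < psi ^ 2) :
    graphS2core.PosForm (0 + Pi.single 3 r : Fin 9 → ℝ) := by
  intro x hx
  obtain ⟨y1, hy1⟩ := exists_eq_lambdaStar_mul (x 1)
  obtain ⟨y3, hy3⟩ := exists_eq_lambdaStar_mul (x 3)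
  obtain ⟨y5, hy5⟩ := exists_eq_lambdaStar_mul (x 5)
  obtain ⟨y6, hy6⟩ := exists_eq_lambdaStar_mul (x 6)
  obtain ⟨y7, hy7⟩ := exists_eq_lambdaStar_mul (x 7)
  by_contra hc
  simp only [sum_weight_add_single, adjForm_graphS2core, sum_fin_nine, Pi.zero_apply,
    sub_zero, one_mul, not_lt] at hc
  obtain ⟨p1, p2⟩ := psi_bounds
  have n0 := term_nonneg (d := (2 * psi + 3))
    (l := y1 - (2 * psi - 1) * x 0 - (2 * psi - 1) * x 2) (by linarith)
  have n1 := term_nonneg (d := (2 * psi + 3))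
    (l := y5 + (2 * psi - 1) * x 0 - (2 * psi - 1) * x 4) (by linarith)
  have n2 := term_nonneg (d := (2 * psi + 3))
    (l := y7 + (2 * psi - 1) * x 8 - (2 * psi - 1) * x 0) (by linarith)
  have n3 := term_nonneg (d := (-2 * psi + 2))
    (l := x 8 - (psi + 2) / 2 * y6 + psi / 2 * x 0) (by linarith)
  have n4 := term_nonneg (d := (3 * psi + 4) / 2)
    (l := y6 - (2 * psi - 1) * x 0 + (6 * psi - 2) / 5 * x 2 - (6 * psi - 2) / 5 * x 4)
    (by linarith)
  have n5 := term_nonneg (d := (-8 * psi + 5))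
    (l := x 0) (by linarith)
  have n6 := term_nonneg (d := (-16 * psi + 12) / 5)
    (l := x 2 + (psi + 1) / 2 * x 4 - (4 * psi + 7) / 4 * y3) (by linarith)
  have n7 := term_nonneg (d := (-3 * psi + 2))
    (l := x 4 - (psi + 2) / 2 * y3) (by linarith)
  have n8 := term_nonneg (d := (psi ^ 2 - r) * (3 + 2 * psi))
    (l := y3) (by nlinarith)
  have hle :
      (2 * psi + 3) * (y1 - (2 * psi - 1) * x 0 - (2 * psi - 1) * x 2) ^ 2 +
      (2 * psi + 3) * (y5 + (2 * psi - 1) * x 0 - (2 * psi - 1) * x 4) ^ 2 +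
      (2 * psi + 3) * (y7 + (2 * psi - 1) * x 8 - (2 * psi - 1) * x 0) ^ 2 +
      (-2 * psi + 2) * (x 8 - (psi + 2) / 2 * y6 + psi / 2 * x 0) ^ 2 +
      ((3 * psi + 4) / 2) * (y6 - (2 * psi - 1) * x 0 + (6 * psi - 2) / 5 * x 2 - (6 * psi -
        2) / 5 * x 4) ^ 2 +
      (-8 * psi + 5) * (x 0) ^ 2 +
      ((-16 * psi + 12) / 5) * (x 2 + (psi + 1) / 2 * x 4 - (4 * psi + 7) / 4 * y3) ^ 2 +
      (-3 * psi + 2) * (x 4 - (psi + 2) / 2 * y3) ^ 2 + ((psi ^ 2 - r) * (3 +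
        2 * psi)) * y3 ^ 2 ≤ 0 := by
    refine nonpos_of_lambdaStar_mul ?_
    rw [hy1, hy3, hy5, hy6, hy7] at hc
    linear_combination hc - lambdaStar * (
        y1 ^ 2 + (1 - r) * y3 ^ 2 + y5 ^ 2 + y6 ^ 2 + y7 ^ 2) * lambdaStar_sq' - lambdaStar * (
        (-59 * psi + 30) / 2 * x 0 ^ 2 + (-254 * psi + 118) / 25 * x 2 ^ 2 +
        (39 * psi + 127) / 20 * y3 ^ 2 + (-234 * psi + 123) / 25 * x 4 ^ 2 +
        (psi + 2) / 2 * y6 ^ 2 + (-8 * psi + 4) * x 8 ^ 2 + 8 * x 0 * y1 + 8 * y1 * x 2 +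
        (-32) / 5 * x 2 * y3 + (-16 * psi - 31) / 5 * y3 * x 4 + 8 * x 4 * y5 +
        (-psi + 6) * x 0 * y6 + 18 / 5 * x 4 * y6 + 8 * x 0 * y7 + (-2) * y6 * x 8 +
        (-8) * x 0 * y5 + (-18) / 5 * x 2 * y6 + (-8) * y7 * x 8 +
        (-44 * psi + 22) / 5 * x 0 * x 2 + (44 * psi - 22) / 5 * x 0 * x 4 +
        (16 * psi - 6) * x 0 * x 8 + (108 * psi + 44) / 25 * x 2 * x 4) * psi_sq
  have z0 := eq_zero_of_term n0 (by linarith)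
  have z1 := eq_zero_of_term n1 (by linarith)
  have z2 := eq_zero_of_term n2 (by linarith)
  have z3 := eq_zero_of_term n3 (by linarith)
  have z4 := eq_zero_of_term n4 (by linarith)
  have z5 := eq_zero_of_term n5 (by linarith)
  have z6 := eq_zero_of_term n6 (by linarith)
  have z7 := eq_zero_of_term n7 (by linarith)
  have z8 := eq_zero_of_term n8 (by linarith)
  simp only [z8, mul_zero, sub_zero] at z7
  simp only [z7, z8, mul_zero, add_zero, sub_zero] at z6
  simp only [z5, z6, z7, mul_zero, add_zero, sub_zero] at z4
  simp only [z4, z5, mul_zero, add_zero, sub_zero] at z3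
  simp only [z3, z5, mul_zero, add_zero, sub_zero] at z2
  simp only [z5, z7, mul_zero, add_zero, sub_zero] at z1
  simp only [z5, z6, mul_zero, sub_zero] at z0
  rw [z0, mul_zero] at hy1
  rw [z8, mul_zero] at hy3
  rw [z1, mul_zero] at hy5
  rw [z4, mul_zero] at hy6
  rw [z2, mul_zero] at hy7
  apply hx
  ext i
  fin_cases i
  exacts [z5, hy1, z6, hy3, z7, hy5, hy6, hy7, z3]

theorem adjForm_theta_six (x : Option (Fin 6) → ℝ) : (theta 6).adjForm x =
    2 * (x (some 0) * x (some 1) + x (some 1) * x (some 2) + x (some 2) * x (some 3) +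
      x (some 3) * x (some 4) + x (some 4) * x (some 5) + x (some 0) * x (some 5) +
      x (some 1) * x none - x (some 5) * x none) := by
  rw [theta_adjForm (by norm_num), adjForm_cycle_six_one]
  simp only [Fin.mk_one, Nat.add_one_sub_one, Fin.reduceFinMk]
  ring

/-- Eliminating the 6-cycle leaves exactly ψ² - r at the outer vertex. -/
theorem theta_six_posForm {r : ℝ} (hr : r < psi ^ 2) :
    (theta 6).PosForm (0 + Pi.single none r : Option (Fin 6) → ℝ) := by
  intro x hx
  obtain ⟨y1, hy1⟩ := exists_eq_lambdaStar_mul (x (some 1))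
  obtain ⟨y3, hy3⟩ := exists_eq_lambdaStar_mul (x (some 3))
  obtain ⟨y5, hy5⟩ := exists_eq_lambdaStar_mul (x (some 5))
  by_contra hc
  simp only [sum_weight_add_single, adjForm_theta_six, Fintype.sum_option, Fin.sum_univ_six,
    Pi.zero_apply,
    sub_zero, one_mul, not_lt] at hc
  obtain ⟨p1, p2⟩ := psi_bounds
  have n0 := term_nonneg (d := 1)
    (l := x (some 0) - y1 - y5) (by linarith)
  have n1 := term_nonneg (d := (2 * psi + 2))
    (l := y1 - psi / 2 * x (some 2) - psi / 2 * y5 - psi / 2 * x none) (by linarith)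
  have n2 := term_nonneg (d := (-psi + 2) / 2)
    (l := x (some 2) - (2 * psi + 6) / 5 * y3 - (2 * psi + 1) / 5 * y5 - (2 * psi + 1) / 5 * x none)
    (by linarith)
  have n3 := term_nonneg (d := (8 * psi + 9) / 5)
    (l := y3 - (8 * psi - 1) / 11 * x (some 4) - (-2 * psi + 3) / 11 * y5 - (-2 * psi +
      3) / 11 * x none)
    (by linarith)
  have n4 := term_nonneg (d := (-8 * psi + 12) / 11)
    (l := x (some 4) - (psi + 3) / 2 * y5 - 1 / 4 * x none) (by linarith)
  have n5 := term_nonneg (d := psi)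
    (l := y5 + psi / 2 * x none) (by linarith)
  have n6 := term_nonneg (d := (psi ^ 2 - r))
    (l := x none) (by linarith)
  have hle :
      1 * (x (some 0) - y1 - y5) ^ 2 +
      (2 * psi + 2) * (y1 - psi / 2 * x (some 2) - psi / 2 * y5 - psi / 2 * x none) ^ 2 +
      ((-psi + 2) / 2) * (x (some 2) - (2 * psi + 6) / 5 * y3 - (2 * psi + 1) / 5 * y5 -
        (2 * psi + 1) / 5 * x none) ^ 2 +
      ((8 * psi + 9) / 5) * (y3 - (8 * psi - 1) / 11 * x (some 4) - (-2 * psi + 3) / 11 * y5 -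
        (-2 * psi + 3) / 11 * x none) ^ 2 +
      ((-8 * psi + 12) / 11) * (x (some 4) - (psi + 3) / 2 * y5 - 1 / 4 * x none) ^ 2 +
      (psi) * (y5 + psi / 2 * x none) ^ 2 + (psi ^ 2 - r) * (x none) ^ 2 ≤ 0 := by
    refine nonpos_of_lambdaStar_mul ?_
    rw [hy1, hy3, hy5] at hc
    linear_combination hc - lambdaStar * (
        y1 ^ 2 + y3 ^ 2 + y5 ^ 2) * lambdaStar_sq' - lambdaStar * (
        (-psi) / 2 * x (some 2) ^ 2 + (2 * psi + 6) / 25 * y3 ^ 2 +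
        (-512 * psi + 64) / 605 * x (some 4) ^ 2 + (-1761 * psi + 3802) / 6050 * y5 ^ 2 +
        (-8747 * psi - 9171) / 12100 * x none ^ 2 + 2 * y1 * x (some 2) +
        (-2) / 5 * x (some 2) * y3 + 128 / 55 * y3 * x (some 4) +
        (256 * psi - 824) / 605 * x (some 4) * y5 + 2 * y1 * x none +
        (-2861 * psi - 2523) / 3025 * y5 * x none + 2 * y1 * y5 +
        (-5 * psi - 2) / 5 * x (some 2) * y5 + (-5 * psi - 2) / 5 * x (some 2) * x none +
        (44 * psi - 138) / 275 * y3 * y5 + (44 * psi - 138) / 275 * y3 * x none +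
        (256 * psi - 384) / 605 * x (some 4) * x none) * psi_sq
  have z0 := eq_zero_of_term n0 (by linarith)
  have z1 := eq_zero_of_term n1 (by linarith)
  have z2 := eq_zero_of_term n2 (by linarith)
  have z3 := eq_zero_of_term n3 (by linarith)
  have z4 := eq_zero_of_term n4 (by linarith)
  have z5 := eq_zero_of_term n5 (by linarith)
  have z6 := eq_zero_of_term n6 (by linarith)
  simp only [z6, mul_zero, add_zero] at z5
  simp only [z5, z6, mul_zero, sub_zero] at z4
  simp only [z4, z5, z6, mul_zero, sub_zero] at z3
  simp only [z3, z5, z6, mul_zero, sub_zero] at z2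
  simp only [z2, z5, z6, mul_zero, sub_zero] at z1
  simp only [z1, z5, sub_zero] at z0
  rw [z1, mul_zero] at hy1
  rw [z3, mul_zero] at hy3
  rw [z5, mul_zero] at hy5
  apply hx
  ext (_ | i)
  · exact z6
  · fin_cases i
    exacts [z0, hy1, z2, hy3, z4, hy5]

/-! ### Weights of attached paths -/

theorem neg_psi_sq_lt_one : -psi ^ 2 < 1 := by linarith [sq_nonneg psi]

theorem psi_lt_one : psi < 1 := by linarith [psi_bounds.2]

theorem psi_cube : psi ^ 3 = 2 * psi - 1 := by linear_combination (psi - 1) * psi_sq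

/-- Since 1 - u ≠ 0, the recursion determines the next weight; the explicit values follow without
inverting in ℚ(ψ). -/
theorem ratio_succ_eq {c u v : ℝ} (hc : c < 1) {n : ℕ} (hu : ratio c n = u)
    (h : v * (1 - u) = psi ^ 3) : ratio c (n + 1) = v := by
  have h1 := ratio_succ hc n
  have h2 := ratio_lt_one hc n
  rw [hu] at h1 h2
  exact mul_right_cancel₀ (sub_pos.2 h2).ne' (h1.trans h.symm)

theorem ratio_psi_one : ratio psi 1 = psi ^ 3 :=
  ratio_succ_eq psi_lt_one ratio_psi_zero (by ring)

theorem ratio_psi_two : ratio psi 2 = psi / 2 :=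
  ratio_succ_eq psi_lt_one ratio_psi_one (by linear_combination (-(psi / 2 * (psi + 1))) * psi_sq)

theorem ratio_neg_zero : ratio (-psi ^ 2) 0 = (2 * psi + 1) / 5 := by
  have h : 1 + psi ^ 2 ≠ 0 := by positivity
  simp only [ratio, pow_zero, mul_one, sub_neg_eq_add]
  rw [div_eq_iff h]
  linear_combination (3 / 5 * psi + 1 / 5) * psi_sq

theorem ratio_neg_zero' : ratio (-psi ^ 2) 0 = 1 / √5 := by
  have h := Real.sq_sqrt (show (0 : ℝ) ≤ 5 by norm_num)
  rw [ratio_neg_zero, psi, eq_div_iff (by positivity)]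
  linear_combination h / 5

theorem ratio_neg_one : ratio (-psi ^ 2) 1 = (3 * psi - 1) / 2 :=
  ratio_succ_eq neg_psi_sq_lt_one ratio_neg_zero
    (by linear_combination (-psi + 2 / 5) * psi_sq)

theorem ratio_neg_two : ratio (-psi ^ 2) 2 = 2 * psi / 3 :=
  ratio_succ_eq neg_psi_sq_lt_one ratio_neg_one (by linear_combination (-psi) * psi_sq)

theorem ratio_neg_three : ratio (-psi ^ 2) 3 = (12 * psi - 3) / 11 :=
  ratio_succ_eq neg_psi_sq_lt_one ratio_neg_two (by linear_combination (-psi + 3 / 11) * psi_sq)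

theorem ratio_neg_four : ratio (-psi ^ 2) 4 = (8 * psi - 1) / 10 :=
  ratio_succ_eq neg_psi_sq_lt_one ratio_neg_three (by linear_combination (-psi + 7 / 55) * psi_sq)

/-- The distance of the weights to their common limit `psi ^ 2`. -/
theorem ratio_eq {c : ℝ} (hc : c < 1) (n : ℕ) :
    ratio c n = psi ^ 2 - psi ^ 3 * (c * psi ^ n) / (1 - c * psi ^ n) := by
  have h := mul_psi_pow_lt_one hc n
  have h' : 1 - c * psi ^ n ≠ 0 := by linarith
  rw [ratio, eq_sub_iff_add_eq, ← add_div, div_eq_iff h']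
  linear_combination (c * psi ^ n * psi) * psi_sq

theorem ratio_psi_lt (n : ℕ) : ratio psi n < psi ^ 2 := by
  have h := mul_psi_pow_lt_one psi_lt_one n
  have hp := psi_pos
  rw [ratio_eq psi_lt_one]
  have : 0 < psi ^ 3 * (psi * psi ^ n) / (1 - psi * psi ^ n) :=
    div_pos (by positivity) (by linarith)
  linarith

/-- The lengths a and a - 1 are matched so that both paths involve the same z = ψ^{a+1}, once as z
and once as -z. The gain ψ³z/(1 + z) over ψ² is smaller than the loss ψ³z/(1 - z), and 2ψ² + ψ³ = 1.
-/
theorem ratio_sum_lt {a : ℕ} (ha : 1 ≤ a) :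
    ratio (-psi ^ 2) (a - 1) + psi ^ 3 + ratio psi a < 1 := by
  obtain ⟨n, rfl⟩ : ∃ n, a = n + 1 := ⟨a - 1, by omega⟩
  have h := mul_psi_pow_lt_one psi_lt_one (n + 1)
  have hp := psi_pos
  rw [ratio_eq psi_lt_one, ratio_eq neg_psi_sq_lt_one, Nat.add_sub_cancel,
    show -psi ^ 2 * psi ^ n = -(psi * psi ^ (n + 1)) by ring]
  have hz : 0 < psi * psi ^ (n + 1) := by positivity
  generalize psi * psi ^ (n + 1) = z at h hz
  have h1 : psi ^ 3 * z / (1 + z) < psi ^ 3 * z / (1 - z) :=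
    div_lt_div_of_pos_left (by positivity) (by linarith) (by linarith)
  have h2 : psi ^ 3 * -z / (1 - -z) = -(psi ^ 3 * z / (1 + z)) := by
    rw [sub_neg_eq_add]; ring
  rw [h2]
  linarith [psi_cube, psi_sq]

theorem cycle_four_posForm_of_lt {q t r : ℝ} (hq : q = 2 * psi - 1)
    (hr : r < psi ^ 2) (h : (t - psi ^ 2) * (1 - 3 / 2 * psi + (psi ^ 2 - r)) <
      (1 - 3 / 2 * psi) * (psi ^ 2 - r)) :
    (cycle 4 (-1)).PosForm (0 + Pi.single 2 t + Pi.single 1 q + Pi.single 0 r : Fin 4 → ℝ) := by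
  intro x hx
  obtain ⟨y1, hy1⟩ := exists_eq_lambdaStar_mul (x 1)
  obtain ⟨y3, hy3⟩ := exists_eq_lambdaStar_mul (x 3)
  by_contra hc
  simp only [sum_weight_add_single, adjForm_cycle_four, Fin.sum_univ_four, Pi.zero_apply,
    sub_zero, one_mul, not_lt] at hc
  obtain ⟨p1, p2⟩ := psi_bounds
  -- Eliminating vertices 1 and 3 leaves c(x₀ - x₂)² + g·x₀² - (t - ψ²)x₂². Minimising over x₀ puts
  -- c and g in series, with constant cg/(c + g).
  obtain ⟨c, hcd⟩ : ∃ c, c = 1 - 3 / 2 * psi := ⟨_, rfl⟩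
  obtain ⟨g, hg⟩ : ∃ g, g = psi ^ 2 - r := ⟨_, rfl⟩
  rw [← hcd, ← hg] at h
  have hcg : 0 < c + g := by linarith
  have e : (c + g) * (x 0 - c / (c + g) * x 2) ^ 2 + (c * g / (c + g) - (t - psi ^ 2)) * x 2 ^ 2 =
      c * (x 0 - x 2) ^ 2 + g * x 0 ^ 2 - (t - psi ^ 2) * x 2 ^ 2 := by
    field_simp; ring
  have n0 := term_nonneg (d := 2 * psi + 2) (l := y1 - psi / 2 * (x 0 + x 2)) (by linarith)
  have n1 := term_nonneg (d := 2 * psi + 3) (l := y3 - (2 * psi - 1) * (x 2 - x 0)) (by linarith)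
  have n2 := term_nonneg (d := c + g) (l := x 0 - c / (c + g) * x 2) hcg
  have n3 := term_nonneg (d := c * g / (c + g) - (t - psi ^ 2)) (l := x 2)
    (by rw [sub_pos, lt_div_iff₀ hcg]; exact h)
  have hle : (2 * psi + 2) * (y1 - psi / 2 * (x 0 + x 2)) ^ 2 +
      (2 * psi + 3) * (y3 - (2 * psi - 1) * (x 2 - x 0)) ^ 2 +
      ((c + g) * (x 0 - c / (c + g) * x 2) ^ 2 +
        (c * g / (c + g) - (t - psi ^ 2)) * x 2 ^ 2) ≤ 0 := by
    refine nonpos_of_lambdaStar_mul ?_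
    rw [e, hcd, hg]
    rw [hy1, hy3, hq] at hc
    linear_combination hc - lambdaStar * ((2 - 2 * psi) * y1 ^ 2 + y3 ^ 2) * lambdaStar_sq' -
      lambdaStar * (2 * y1 * x 0 + 2 * y1 * x 2 - 4 * y1 ^ 2 - 8 * x 0 * y3 + 8 * x 2 * y3 +
        (15 * psi - 8) * x 0 * x 2 + (3 - 17 / 2 * psi) * (x 0 ^ 2 + x 2 ^ 2)) * psi_sq
  have z0 := eq_zero_of_term n0 (by linarith)
  have z1 := eq_zero_of_term n1 (by linarith)
  have z2 := eq_zero_of_term n2 (by linarith)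
  have z3 := eq_zero_of_term n3 (by linarith)
  simp only [z3, mul_zero, sub_zero] at z2
  simp only [z2, z3, mul_zero, add_zero, sub_zero] at z0 z1
  rw [z0, mul_zero] at hy1
  rw [z1, mul_zero] at hy3
  apply hx
  ext i
  fin_cases i
  exacts [z2, hy1, z3, hy3]

/-- With z = ψ^{n+1} the weights are ψ² - ψ³z/(1 - z) and ψ² + ψ⁴z/(1 + ψz); after clearing
denominators the required inequality is (5/2 - 4ψ)(1 - 2z) > 0. -/
theorem cycle_four_posForm_ratio {n : ℕ} (hn : 1 ≤ n) :
    (cycle 4 (-1)).PosForm (0 + Pi.single 2 (ratio (-psi ^ 2) n) + Pi.single 1 (ratio psi 1) +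
      Pi.single 0 (ratio psi n) : Fin 4 → ℝ) := by
  refine cycle_four_posForm_of_lt (ratio_psi_one.trans psi_cube) (ratio_psi_lt n) ?_
  have hz1 := mul_psi_pow_lt_one psi_lt_one n
  rw [ratio_eq psi_lt_one, ratio_eq neg_psi_sq_lt_one,
    show -psi ^ 2 * psi ^ n = -psi * (psi * psi ^ n) by ring]
  have hp := psi_pos
  obtain ⟨p1, p2⟩ := psi_bounds
  have hz : 0 < psi * psi ^ n := by positivity
  -- Here n ≥ 1 is essential: it gives z ≤ ψ² < 1/2, whereas n = 0 would give z = ψ > 1/2.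
  have hz2 : psi * psi ^ n ≤ 0.382 := by
    have : psi ^ n ≤ psi ^ 1 := pow_le_pow_of_le_one hp.le psi_lt_one.le hn
    nlinarith
  generalize psi * psi ^ n = z at hz1 hz hz2
  have h1 : 0 < 1 - z := by linarith
  have h2 : 0 < 1 + psi * z := by positivity
  have e1 : psi ^ 2 - psi ^ 3 * (-psi * z) / (1 - -psi * z) - psi ^ 2 =
      psi ^ 4 * z / (1 + psi * z) := by
    rw [show 1 - -psi * z = 1 + psi * z by ring]; ring
  rw [e1, sub_sub_cancel]
  rw [← sub_pos]
  have e2 : (1 - 3 / 2 * psi) * (psi ^ 3 * z / (1 - z)) - psi ^ 4 * z / (1 + psi * z) *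
      (1 - 3 / 2 * psi + psi ^ 3 * z / (1 - z)) = psi ^ 3 * z / ((1 - z) * (1 + psi * z)) *
        ((1 - 3 / 2 * psi) * (1 - psi + 2 * psi * z) - psi ^ 4 * z) := by
    field_simp; ring
  rw [e2]
  refine mul_pos (by positivity) ?_
  have e3 : (1 - 3 / 2 * psi) * (1 - psi + 2 * psi * z) - psi ^ 4 * z =
      (5 / 2 - 4 * psi) - (5 - 8 * psi) * z := by
    linear_combination (3 / 2 - (psi ^ 2 - psi + 5) * z) * psi_sq
  rw [e3, show 5 / 2 - 4 * psi - (5 - 8 * psi) * z = (5 / 2 - 4 * psi) * (1 - 2 * z) by ring]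
  exact mul_pos (by linarith) (by linarith)

/-! ### The families -/

theorem add_single_comp_inl {V W : Type*} [DecidableEq V] [DecidableEq W] (a : V ⊕ W → ℝ) (v : V)
    (r : ℝ) : (a + Pi.single (.inl v) r) ∘ .inl = a ∘ .inl + (Pi.single v r : V → ℝ) := by
  ext i
  simp [Pi.single_apply]

/-- Form for iteration: nested paths are removed from the outside while the weights already placed
on the core are kept. -/
theorem PosForm.attachPath_of {V : Type*} [Fintype V] [DecidableEq V] {G : SignedGraph V} {v : V}
    {n : ℕ} {b : V ⊕ Fin n → ℝ} (hb : ∀ j, b (.inr j) = 0)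
    (h : G.PosForm (b ∘ .inl + Pi.single v (ratio psi n))) : (G.attachPath v n).PosForm b := by
  have : Sum.elim (b ∘ .inl) 0 = b := by
    ext (i | j)
    · rfl
    · exact (hb j).symm
  exact this ▸ h.attachPath

/-- The weight 1/√5 demanded by the strip is the starting value of the recursion with c = -ψ². -/
theorem PosForm.attachPath_root {V : Type*} [Fintype V] [DecidableEq V] {G : SignedGraph V} {v : V}
    {n : ℕ} (h : G.PosForm (0 + Pi.single v (ratio (-psi ^ 2) n))) :
    (G.attachPath v n).PosForm (Pi.single (tip v n) (1 / √5)) := by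
  have := h.attachPath_tip neg_psi_sq_lt_one
  rwa [ratio_neg_zero', Sum.elim_zero_zero, zero_add] at this

theorem isBipartite_oppositePendants {k : ℕ} (hk : 4 ≤ k) (he : Even k) :
    (oppositePendants k hk).IsBipartite :=
  ((isBipartite_cycle he _).attachPath _ _).attachPath _ _

theorem posForm_oppositePendants {k : ℕ} (hk : 4 ≤ k) (he : Even k) :
    (oppositePendants k hk).PosForm 0 := by
  refine .attachPath_of (by simp) (.attachPath_of (by simp) ?_)
  rw [Pi.zero_comp, add_single_comp_inl, Pi.zero_comp, ratio_psi_one]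
  exact cycle_posForm hk he

theorem posForm_graphG0 {k : ℕ} (hk : 4 ≤ k) (he : Even k) : (graphG0 k).PosForm 0 := by
  refine .attachPath_of (by simp) ?_
  rw [Pi.zero_comp, ratio_psi_one]
  exact theta_posForm hk he

theorem posForm_graphU6 (n₁ n₂ : ℕ) : (graphU6 n₁ n₂).PosForm 0 := by
  refine .attachPath_of (by simp) (.attachPath_of (by simp) ?_)
  rw [Pi.zero_comp, add_single_comp_inl, Pi.zero_comp]
  exact cycle_six_posForm (ratio_psi_lt _) (ratio_psi_lt _)

theorem posForm_graphC4 (n₁ n₃ : ℕ) : (graphC4 n₁ 1 n₃ 1).PosForm 0 := by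
  refine .attachPath_of (by simp) (.attachPath_of (by simp) (.attachPath_of (by simp)
    (.attachPath_of (by simp) ?_)))
  simp only [Pi.zero_comp, add_single_comp_inl]
  exact cycle_four_posForm_pendants (ratio_psi_one.trans psi_cube) (ratio_psi_lt _) (ratio_psi_lt _)

theorem posForm_graphS1 (n : ℕ) : (graphS1 n).PosForm 0 := by
  refine .attachPath_of (by simp) ?_
  rw [Pi.zero_comp]
  exact theta_six_posForm (ratio_psi_lt _)

theorem posForm_graphS2 (n : ℕ) : (graphS2 n).PosForm 0 := by
  refine .attachPath_of (by simp) ?_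
  rw [Pi.zero_comp]
  exact graphS2core_posForm (ratio_psi_lt _)

theorem posForm_graphG4 : graphG4.PosForm (Pi.single (tip 0 4) (1 / √5)) :=
  .attachPath_root (tromino_posForm ratio_neg_four)

theorem posForm_graphG2 : graphG2.PosForm (Pi.single (tip (.inl 0) 2) (1 / √5)) := by
  refine .attachPath_root (.attachPath_of (by simp) ?_)
  rw [add_single_comp_inl, Pi.zero_comp]
  exact domino_posForm ratio_neg_two (ratio_psi_one.trans psi_cube)

theorem posForm_graphG5 : graphG5.PosForm (Pi.single (tip (.inl 1) 4) (1 / √5)) := by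
  refine .attachPath_root (.attachPath_of (by simp) ?_)
  rw [add_single_comp_inl, Pi.zero_comp]
  exact cycle_four_posForm_adjacent ratio_neg_four ratio_psi_two

theorem posForm_graphQ' {n : ℕ} (hn : 1 ≤ n) :
    (graphQ' n n).PosForm (Pi.single (tip (.inl (.inl 2)) n) (1 / √5)) := by
  refine .attachPath_root (.attachPath_of (by simp) (.attachPath_of (by simp) ?_))
  simp only [Pi.zero_comp, add_single_comp_inl]
  exact cycle_four_posForm_ratio hn

theorem posForm_graphT {a : ℕ} (ha : 1 ≤ a) :
    (graphT a 1 (a - 1)).PosForm (Pi.single (tip (.inl (.inl 0)) (a - 1)) (1 / √5)) := by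
  refine .attachPath_root (.attachPath_of (by simp) (.attachPath_of (by simp) ?_))
  simp only [Pi.zero_comp, add_single_comp_inl, ratio_psi_one]
  intro x hx
  have h0 : x 0 ≠ 0 := fun h => hx (funext fun i => by rw [Subsingleton.elim i 0, h]; rfl)
  have h1 := ratio_sum_lt ha
  simp only [adjForm, Finset.univ_unique, Fin.default_eq_zero,
    Finset.sum_singleton, (path 1).irrefl, SignType.coe_zero, Pi.add_apply, Pi.zero_apply,
    Pi.single_eq_same]
  have : 0 < lambdaStar * ((1 - (ratio (-psi ^ 2) (a - 1) + psi ^ 3 + ratio psi a)) * x 0 ^ 2) :=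
    mul_pos lambdaStar_pos (mul_pos (by linarith) (by positivity))
  linarith

theorem posForm_path_four : (path 4).PosForm (Pi.single 1 (1 / √5)) := by
  have := path_four_posForm ratio_neg_zero
  rwa [ratio_neg_zero', zero_add] at this

theorem IsEndPiece.posForm {L : RootedSignedGraph} (h : IsEndPiece L) :
    ∃ _ : Fintype L.V, L.graph.IsBipartite ∧ L.graph.PosForm (Pi.single L.root (1 / √5)) := by
  have hc : (cycle 4 (-1)).IsBipartite := isBipartite_cycle (by decide) _
  cases h with
  | g4 => exact ⟨_, isBipartite_tromino.attachPath _ _, posForm_graphG4⟩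
  | g2 => exact ⟨_, (isBipartite_domino.attachPath _ _).attachPath _ _, posForm_graphG2⟩
  | t a ha => exact ⟨_, (((isBipartite_path 1).attachPath _ _).attachPath _ _).attachPath _ _,
      posForm_graphT (by omega)⟩
  | q n hn => exact ⟨_, ((hc.attachPath _ _).attachPath _ _).attachPath _ _, posForm_graphQ' hn⟩
  | g5 => exact ⟨_, (hc.attachPath _ _).attachPath _ _, posForm_graphG5⟩
  | p4 => exact ⟨_, isBipartite_path 4, posForm_path_four⟩

theorem InFamilyIII.rho_lt {V : Type*} [Fintype V] [DecidableEq V] {G : SignedGraph V}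
    (hG : G.InFamilyIII) : G.rho < lambdaStar := by
  rcases hG with ⟨k, hk, he, h⟩ | ⟨k, hk, he, h⟩ | ⟨n₁, n₂, -, -, h⟩ | ⟨n₁, n₃, -, -, h⟩ |
    ⟨n, -, h⟩ | ⟨n, -, h⟩
  · exact h.rho_lt (isBipartite_oppositePendants hk he) (posForm_oppositePendants hk he)
  · exact h.rho_lt ((isBipartite_theta he).attachPath _ _) (posForm_graphG0 (by omega) he)
  · exact h.rho_lt (((isBipartite_cycle (by decide) _).attachPath _ _).attachPath _ _)
      (posForm_graphU6 n₁ n₂)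
  · exact h.rho_lt (((((isBipartite_cycle (by decide) _).attachPath _ _).attachPath _ _).attachPath
      _ _).attachPath _ _) (posForm_graphC4 n₁ n₃)
  · exact h.rho_lt ((isBipartite_theta (by decide)).attachPath _ _) (posForm_graphS1 n)
  · exact h.rho_lt (isBipartite_graphS2core.attachPath _ _) (posForm_graphS2 n)

theorem InFamilyIV.rho_lt {V : Type*} [Fintype V] [DecidableEq V] {G : SignedGraph V}
    (hG : G.InFamilyIV) : G.rho < lambdaStar := by
  obtain ⟨L, R, s, hs, hL, hR, h⟩ := hG
  obtain ⟨_, bL, pL⟩ := hL.posForm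
  obtain ⟨_, bR, pR⟩ := hR.posForm
  exact h.rho_lt ((bL.bridge (isBipartite_strip s) _ _).bridge bR _ _) (pL.stripJoin hs pR)

end SignedGraph

/-- Every signed graph in the infinite families has spectral radius less than `λ*`. -/
theorem lemmaA {V : Type*} [Fintype V] [DecidableEq V] (G : SignedGraph V)
    (hG : G.InFamilyIII ∨ G.InFamilyIV) : G.rho < lambdaStar := by
  rcases hG with h | h
  · exact h.rho_lt
  · exact h.rho_lt
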